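/- **Definitions.** Order $\{0,1\}^n$ coordinatewise. A *violation of $k$-monotonicity* of $f:\{0,1\}^n\to\{0,1\}$ is a sequence $x_1\prec\dots\prec x_{k+1}$ with $f(x_1)=1$ and $f(x_i)\ne f(x_{i+1})$ for $1\le i\le k$; $f$ is *$k$-monotone* if it has none. $f$ is *$\varepsilon$-far* from $s$-monotone if every $s$-monotone $h$ satisfies $|\{x: f(x)\neq h(x)\}|\ge \varepsilon 2^n$. A chain $0^n=z_0\prec z_1\prec\dots\prec z_n=1^n$ *detects* a violation if all points of some violation lie on it. The *orbit* of $f$ is the set of all functions obtained from $f$ by permuting the $n$ coordinates. A *balanced blocks function* with $\ell$ blocks on $\{0,1\}^m$ is obtained by partitioning $\{0,1\}^m$ into consecutive blocks $B_1,\dots,B_\ell$, each consisting of all points in consecutive Hamming levels, with $(1-\frac{\ell}{\sqrt m})\frac{2^m}{\ell}\le |B_i|\le (1+\frac{\ell}{\sqrt m})\frac{2^m}{\ell}$; it equals $1$ on $B_1$, is constant on each block and alternates between consecutive blocks. For $1\le k\le s$ put $n_R=\lfloor n k^2/(625 s^2)\rfloor$. We say that $f:\{0,1\}^n\to\{0,1\}$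 *hides a balanced blocks function* (with parameters $k,s$) if there is a set $R$ of $n_R$ coordinates, with complement $L$ of size $n_L=n-n_R$, and a balanced blocks function $b$ on $\{0,1\}^R$ with $3s$ blocks such that, for all $z=(x,y)\in\{0,1\}^L\times\{0,1\}^R$: $f(z)=b(y)$ if $\bigl||x|-\frac{n_L}{2}\bigr|\le\frac{\sqrt{n_L}}{100}$; $f(z)=0$ if $|x|<\frac{n_L}{2}-\frac{\sqrt{n_L}}{100}$; and if $|x|>\frac{n_L}{2}+\frac{\sqrt{n_L}}{100}$ then $f(z)=0$ for even $k$ and $f(z)=1$ for odd $k$. **Theorem.** There are absolute constants $C,\varepsilon>0$ such that the following holds. Let $k=k(n)$ and $g=g(k(n),n)$ be integers with $2\le k\le g$ for all large $n$ and $g=o(\sqrt n)$ as $n\to\infty$. Then there are functions $f_n:\{0,1\}^n\to\{0,1\}$ such that, with $\mathcal F_n$ the orbit of $f_n$: 1. For all sufficiently large $n$, every $f\in\mathcal F_n$ is $\varepsilon$-far from $g$-monotone, and a uniformly random chain $0^n=z_0\prec\dots\prec z_n=1^n$ detects a violation of $k$-monotonicity of $f$ with probability at most $\exp\left(-C\frac{\sqrt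 n}{(g/k)^2}\right)$. 2. If $\frac{\sqrt n}{(g/k)^2}\to\infty$, then this probability is moreover $o\left(\exp\left(-C\frac{\sqrt n}{(g/k)^2}\right)\right)$ as $n\to\infty$, uniformly over $f\in\mathcal F_n$. 3. If $3g=o(\sqrt{n_R})$, where $n_R=\lfloor n k^2/(625 g^2)\rfloor$, then for all sufficiently large $n$ the function $f_n$ hides a balanced blocks function with parameters $k,g$. -/

import Mathlib

open Filter Asymptotics

/-- The Boolean hypercube on a set of coordinates, with the coordinatewise order
(`false < true`). -/
abbrev Cube (ι : Type) : Type := ι → Bool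

/-- Boolean functions on the `n`-dimensional hypercube. -/
abbrev BoolFn (n : ℕ) : Type := Cube (Fin n) → Bool

/-- Hamming weight of `z` on the set `S` of coordinates. -/
def weightOn {ι : Type} (S : Finset ι) (z : Cube ι) : ℕ :=
  (S.filter fun i => z i = true).card

/-- Hamming weight. -/
def weight {ι : Type} [Fintype ι] (z : Cube ι) : ℕ := weightOn Finset.univ z

/-- A violation of `k`-monotonicity: `x₁ ≺ ⋯ ≺ x_{k+1}` with `f x₁ = 1` and
`f xᵢ ≠ f xᵢ₊₁` for `1 ≤ i ≤ k`. -/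
def IsViolation {n : ℕ} (k : ℕ) (f : BoolFn n) (x : Fin (k + 1) → Cube (Fin n)) : Prop :=
  StrictMono x ∧ f (x 0) = true ∧ ∀ j : Fin k, f (x j.castSucc) ≠ f (x j.succ)

/-- The `k`-monotone functions: those without a violation. -/
def kMonotone (n k : ℕ) : Set (BoolFn n) := {f | ¬ ∃ x, IsViolation k f x}

/-- Normalized Hamming distance. -/
noncomputable def hammingFrac {n : ℕ} (f h : BoolFn n) : ℝ :=
  ((Finset.univ.filter fun x => f x ≠ h x).card : ℝ) / 2 ^ n

/-- `f` is `ε`-far from the property `P`. -/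
def IsFar {n : ℕ} (ε : ℝ) (f : BoolFn n) (P : Set (BoolFn n)) : Prop :=
  ∀ h ∈ P, ε ≤ hammingFrac f h

/-- The maximal chains `0ⁿ = z₀ ≺ z₁ ≺ ⋯ ≺ z_n = 1ⁿ`. -/
def IsFullChain {n : ℕ} (Z : Fin (n + 1) → Cube (Fin n)) : Prop :=
  StrictMono Z ∧ Z 0 = (fun _ => false) ∧ Z (Fin.last n) = fun _ => true

/-- The chain `Z` reveals a violation of `k`-monotonicity of `f`. -/
def Detects {n : ℕ} (k : ℕ) (f : BoolFn n) (Z : Fin (n + 1) → Cube (Fin n)) : Prop :=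
  ∃ x, IsViolation k f x ∧ ∀ j, x j ∈ Set.range Z

open Classical in
/-- Probability that a uniformly random maximal chain reveals a violation of
`k`-monotonicity of `f`. -/
noncomputable def detectionProb {n : ℕ} (k : ℕ) (f : BoolFn n) : ℝ :=
  ((Finset.univ.filter fun Z : Fin (n + 1) → Cube (Fin n) =>
      IsFullChain Z ∧ Detects k f Z).card : ℝ) /
    ((Finset.univ.filter fun Z : Fin (n + 1) → Cube (Fin n) => IsFullChain Z).card : ℝ)

/-- All functions obtained from `f` by permuting the coordinates. -/
def coordOrbit {n : ℕ} (f : BoolFn n) : Set (BoolFn n) :=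
  {h | ∃ σ : Equiv.Perm (Fin n), h = fun x => f (fun i => x (σ i))}

/-- `h` is a balanced blocks function with `ℓ` blocks on the cube over `ι` (with `m = |ι|`):
the `i`-th block (`i = 0, …, ℓ - 1`) consists of all points of weight in `[c i, c (i+1))`, every
block has `(1 ± ℓ/√m) 2^m/ℓ` points, and `h` is `1` on the first block and alternates from
one block to the next. -/
def IsBalancedBlocks {ι : Type} [Fintype ι] (ℓ : ℕ) (h : Cube ι → Bool) : Prop :=
  ∃ c : ℕ → ℕ, Monotone c ∧ c 0 = 0 ∧ c ℓ = Fintype.card ι + 1 ∧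
    ∀ i < ℓ,
      (1 - (ℓ : ℝ) / √(Fintype.card ι)) * (2 ^ Fintype.card ι / ℓ) ≤
          (Nat.card {y : Cube ι // c i ≤ weight y ∧ weight y < c (i + 1)} : ℝ) ∧
      (Nat.card {y : Cube ι // c i ≤ weight y ∧ weight y < c (i + 1)} : ℝ) ≤
          (1 + (ℓ : ℝ) / √(Fintype.card ι)) * (2 ^ Fintype.card ι / ℓ) ∧
      ∀ y : Cube ι, c i ≤ weight y → weight y < c (i + 1) → (h y = true ↔ Even i)

/-- Number of hidden coordinates, `n / (625 (s/k)²)` rounded down. -/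
def numHidden (n k s : ℕ) : ℕ := n * k ^ 2 / (625 * s ^ 2)

/-- `f` hides a balanced blocks function with `3s` blocks on a set `R` of
`numHidden n k s` coordinates: with `L` the other coordinates, `f z` is the balanced blocks
function of `z|_R` if the weight of `z|_L` is within `√|L| / 100` of `|L| / 2`; below that range
`f` is `0`, above it `f` is `0` if `k` is even and `1` if `k` is odd. -/
def HidesBalancedBlocks {n : ℕ} (k s : ℕ) (f : BoolFn n) : Prop :=
  ∃ R : Finset (Fin n), R.card = numHidden n k s ∧
    ∃ bb : Cube {i // i ∈ R} → Bool, IsBalancedBlocks (3 * s) bb ∧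
      ∀ z : Cube (Fin n),
        (|(weightOn Rᶜ z : ℝ) - (Rᶜ.card : ℝ) / 2| ≤ √(Rᶜ.card) / 100 →
            f z = bb fun i => z i) ∧
        ((weightOn Rᶜ z : ℝ) < (Rᶜ.card : ℝ) / 2 - √(Rᶜ.card) / 100 → f z = false) ∧
        ((Rᶜ.card : ℝ) / 2 + √(Rᶜ.card) / 100 < (weightOn Rᶜ z : ℝ) →
            (f z = true ↔ Odd k))

/-! ### Binomial coefficients -/

/-! The hard functions show a function `G` of some of the coordinates only while the weight on the
other coordinates `L` lies within `√|L| / 100` of the middle (`hide`). The constants outside this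
window are chosen so that a violation of `k`-monotonicity lies inside it. While a random chain
crosses the window it makes `O(√n)` steps in `L`. A chain that detects must in that time also make
at least `D` relevant steps, that is, set coordinates on which the value of `G` may currently
depend. If at most `M` coordinates are relevant at any point, about `M / √n` relevant steps are
expected. An exponential moment (`sum_prod_step_le`, `card_relevant_steps_le`) then bounds the
detection probability by `exp (O(M / √n) - D log 2)` (`detectionProb_hide_window_le`).

Farness from `g`-monotone rests on `exists_rank`: a `g`-monotone function is the parity of a
monotone rank with values in `{0, …, g}`. Restricting the rank to the slices of the window, which
hold a constant fraction of the cube, reduces the claim to `FarFromRanks` for `G` (`isFar_hide`).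

Write `E = √n / (g/k)²`. There are two choices of `G`.

Blocks, when `r = numHidden n k g` satisfies `6g ≤ √r`: `G` is the balanced blocks function with
`3g` blocks on `r` coordinates. A block has at least `√r / (6g)` levels, so `k` alternations force
about `k√r / g` steps, which is of order `E`, as is the expected number `r / √n`; the factor `625`
in `numHidden` makes the forced number the larger one. A rank matching `G` would have to rise once
for each of about `3g/2` pairs of blocks, but it can rise at most `g` times
(`farFromRanks_blockFn`).

Two levels, when `√r < 6g`: now `E = O(k)`, so a bound `exp (-ck)` is enough. With `m` of order `g`,
an address of `m` bits selects one of `m` blocks of `m` bits, and `G` is the parity of the weight of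
that block. Only `2m = O(√n)` coordinates are relevant at a time, and each alternation costs a
relevant step. A rank matching `G` must be correlated with the upper half of the addressed block.
Changing an address bit selects another block, and by orthogonality a bounded rank cannot be well
correlated with most of the blocks in advance. So the rank would rise by about `√m` on a typical
address edge, more than a function bounded by `g` can (`farFromRanks_twoLevel`). -/

/-- The factor `3 * p + 1` makes the induction close: the step needs `(3p+4)(2p+1)² ≤
4(p+1)²(3p+1)`, true with a margin of `p`. With `2 * p` instead, the step would fail. -/
theorem centralBinom_sq_le (p : ℕ) : (3 * p + 1) * p.centralBinom ^ 2 ≤ 16 ^ p := by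
  induction p with
  | zero => simp
  | succ p ih =>
    have h := Nat.succ_mul_centralBinom_succ p
    have h2 : (p + 1) ^ 2 * ((3 * (p + 1) + 1) * (p + 1).centralBinom ^ 2) ≤
        (p + 1) ^ 2 * 16 ^ (p + 1) := by
      calc (p + 1) ^ 2 * ((3 * (p + 1) + 1) * (p + 1).centralBinom ^ 2)
          = (3 * p + 4) * ((p + 1) * (p + 1).centralBinom) ^ 2 := by ring
        _ = (3 * p + 4) * (2 * (2 * p + 1)) ^ 2 * p.centralBinom ^ 2 := by rw [h]; ring
        _ ≤ 16 * (p + 1) ^ 2 * (3 * p + 1) * p.centralBinom ^ 2 :=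
            Nat.mul_le_mul_right _ (by nlinarith)
        _ = 16 * (p + 1) ^ 2 * ((3 * p + 1) * p.centralBinom ^ 2) := by ring
        _ ≤ 16 * (p + 1) ^ 2 * 16 ^ p := by gcongr
        _ = (p + 1) ^ 2 * 16 ^ (p + 1) := by ring
    exact Nat.le_of_mul_le_mul_left h2 (by positivity)

/-- The induction step is `4p(p+1) ≤ (2p+1)²`. -/
theorem le_centralBinom_sq (p : ℕ) (hp : 1 ≤ p) : 16 ^ p ≤ 4 * p * p.centralBinom ^ 2 := by
  induction p, hp using Nat.le_induction with
  | base => simp [Nat.centralBinom, Nat.choose]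
  | succ p hp ih =>
    have h := Nat.succ_mul_centralBinom_succ p
    have h2 : (p + 1) ^ 2 * 16 ^ (p + 1) ≤
        (p + 1) ^ 2 * (4 * (p + 1) * (p + 1).centralBinom ^ 2) := by
      calc (p + 1) ^ 2 * 16 ^ (p + 1) = 16 * (p + 1) ^ 2 * 16 ^ p := by ring
        _ ≤ 16 * (p + 1) ^ 2 * (4 * p * p.centralBinom ^ 2) := by gcongr
        _ = 16 * (p + 1) * (4 * (p * (p + 1))) * p.centralBinom ^ 2 := by ring
        _ ≤ 16 * (p + 1) * (2 * p + 1) ^ 2 * p.centralBinom ^ 2 := by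
            gcongr
            nlinarith
        _ = 4 * (p + 1) * (2 * (2 * p + 1) * p.centralBinom) ^ 2 := by ring
        _ = (p + 1) ^ 2 * (4 * (p + 1) * (p + 1).centralBinom ^ 2) := by rw [← h]; ring
    exact Nat.le_of_mul_le_mul_left h2 (by positivity)

theorem mul_choose_sq_le (m w : ℕ) : m * m.choose w ^ 2 ≤ 4 ^ m := by
  have h1 : m.choose w ≤ m.choose (m / 2) := Nat.choose_le_middle w m
  have h2 : m * m.choose (m / 2) ^ 2 ≤ 4 ^ m := by
    obtain ⟨p, hp | hp⟩ := Nat.even_or_odd' m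
    · subst hp
      have := centralBinom_sq_le p
      rw [Nat.centralBinom] at this
      have e : 2 * p / 2 = p := by omega
      rw [e, pow_mul]
      norm_num
      nlinarith [sq_nonneg ((2 * p).choose p)]
    · subst hp
      have h3 := centralBinom_sq_le (p + 1)
      -- In odd dimension the middle coefficient is half of the next central one.
      have h4 : (p + 1).centralBinom = 2 * (2 * p + 1).choose p := by
        rw [Nat.centralBinom, show 2 * (p + 1) = 2 * p + 1 + 1 by ring, Nat.choose_succ_succ,
          Nat.choose_symm_half]
        ring
      have e : (2 * p + 1) / 2 = p := by omega
      rw [e]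
      rw [h4] at h3
      have h5 : (4 : ℕ) ^ (2 * p + 1) = 4 * 16 ^ p := by
        rw [pow_succ, pow_mul]; norm_num; ring
      have h6 : (16 : ℕ) ^ (p + 1) = 16 * 16 ^ p := by ring
      rw [h5]
      rw [h6] at h3
      nlinarith [sq_nonneg ((2 * p + 1).choose p)]
  calc m * m.choose w ^ 2 ≤ m * m.choose (m / 2) ^ 2 := by gcongr
    _ ≤ _ := h2

theorem sqrt_mul_choose_le (m w : ℕ) : √(m : ℝ) * m.choose w ≤ 2 ^ m := by
  have h : ((m * m.choose w ^ 2 : ℕ) : ℝ) ≤ (4 ^ m : ℕ) := by exact_mod_cast mul_choose_sq_le m w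
  push_cast at h
  apply (pow_le_pow_iff_left₀ (by positivity) (by positivity) two_ne_zero).1
  rw [mul_pow, Real.sq_sqrt (by positivity), ← pow_mul, mul_comm m 2, pow_mul]
  norm_num
  exact h

/-- Moving from `p + j` to `p + j + 1` loses at most a fraction `(2j+1)/p` of the central
coefficient, and the odd numbers add up to `j²`. -/
theorem choose_add_lower (p j : ℕ) (hj : j ≤ p) :
    (p.centralBinom : ℝ) * (p - (j : ℝ) ^ 2) ≤ p * ((2 * p).choose (p + j) : ℝ) := by
  induction j with
  | zero => simp [Nat.centralBinom, mul_comm]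
  | succ j ih =>
    have ih := ih (by omega)
    have h1 : ((2 * p).choose (p + j + 1) : ℝ) * (p + j + 1) =
        ((2 * p).choose (p + j) : ℝ) * (p - j) := by
      have := Nat.choose_succ_right_eq (2 * p) (p + j)
      have e : 2 * p - (p + j) = p - j := by omega
      rw [e] at this
      have h2 : (((p - j : ℕ)) : ℝ) = p - j := by
        rw [Nat.cast_sub (by omega)]
      rw [← h2]
      exact_mod_cast this
    have hle : ((2 * p).choose (p + j) : ℝ) ≤ p.centralBinom := by
      exact_mod_cast Nat.choose_le_centralBinom (p + j) p
    have hp : (0 : ℝ) ≤ p := by positivity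
    have hpj : (0 : ℝ) < p + j + 1 := by positivity
    have hx : (j : ℝ) + 1 ≤ p := by exact_mod_cast hj
    -- the ratio is `1 - (2j+1)/(p+j+1)`
    have h3 : ((2 * p).choose (p + j + 1) : ℝ) =
        ((2 * p).choose (p + j) : ℝ) - ((2 * p).choose (p + j) : ℝ) * (2 * j + 1) / (p + j + 1) := by
      field_simp
      linarith
    have h4 : (p : ℝ) * (((2 * p).choose (p + j) : ℝ) * (2 * j + 1) / (p + j + 1)) ≤
        p.centralBinom * (2 * j + 1) := by
      rw [mul_div_assoc', div_le_iff₀ hpj]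
      have : (p : ℝ) * (((2 * p).choose (p + j) : ℝ) * (2 * j + 1)) ≤
          p * (p.centralBinom * (2 * j + 1)) := by gcongr
      have h5 : (p : ℝ) * (p.centralBinom * (2 * j + 1)) ≤
          (p + j + 1) * (p.centralBinom * (2 * j + 1)) := by gcongr; linarith
      linarith
    have e : p + (j + 1) = p + j + 1 := by ring
    rw [e, h3]
    push_cast
    nlinarith

/-- By `choose_add_lower`, a level within `√(p/2)` of the middle keeps at least half of the central
coefficient. -/
theorem choose_two_mul_lower (p v : ℕ) (d : ℝ) (hp : 1 ≤ p) (hd : |(v : ℝ) - p| ≤ d)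
    (hd2 : 2 * d ^ 2 ≤ p) : (4 : ℝ) ^ p ≤ 4 * √p * (2 * p).choose v := by
  have hd0 : 0 ≤ d := le_trans (abs_nonneg _) hd
  have hp' : (1 : ℝ) ≤ p := by exact_mod_cast hp
  have hdp : d ≤ p := by nlinarith
  have hc : (4 : ℝ) ^ p ≤ 2 * √p * p.centralBinom := by
    apply (pow_le_pow_iff_left₀ (by positivity) (by positivity) two_ne_zero).1
    have : ((16 ^ p : ℕ) : ℝ) ≤ (4 * p * p.centralBinom ^ 2 : ℕ) := by
      exact_mod_cast le_centralBinom_sq p hp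
    push_cast at this
    rw [mul_pow, mul_pow, Real.sq_sqrt (by positivity), ← pow_mul, mul_comm p 2, pow_mul]
    norm_num
    exact this
  have main : ∀ j : ℕ, (j : ℝ) ≤ d → (p.centralBinom : ℝ) ≤ 2 * (2 * p).choose (p + j) := by
    intro j hj
    have hjp : j ≤ p := by exact_mod_cast hj.trans hdp
    have h := choose_add_lower p j hjp
    have h2 : (p : ℝ) / 2 ≤ p - (j : ℝ) ^ 2 := by
      have : (j : ℝ) ^ 2 ≤ d ^ 2 := by gcongr
      linarith
    have h3 : (p.centralBinom : ℝ) * (p / 2) ≤ p * ((2 * p).choose (p + j) : ℝ) :=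
      le_trans (by gcongr) h
    have : (p : ℝ) * p.centralBinom ≤ p * (2 * ((2 * p).choose (p + j) : ℝ)) := by linarith
    exact le_of_mul_le_mul_left this (by linarith)
  have h2 : (p.centralBinom : ℝ) ≤ 2 * (2 * p).choose v := by
    rw [abs_le] at hd
    rcases le_total p v with h | h
    · obtain ⟨j, rfl⟩ := Nat.exists_eq_add_of_le h
      exact main j (by push_cast at hd; linarith [hd.2])
    · obtain ⟨j, rfl⟩ := Nat.exists_eq_add_of_le h
      have := main j (by push_cast at hd; linarith [hd.1])
      rwa [show (2 * (v + j)).choose v = (2 * (v + j)).choose (v + j + j) from by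
        rw [← Nat.choose_symm (by omega)]; congr 1; omega]
  calc (4 : ℝ) ^ p ≤ 2 * √p * p.centralBinom := hc
    _ ≤ 2 * √p * (2 * (2 * p).choose v) := by gcongr
    _ = _ := by ring

/-- Levels within about `√n / 2` of the middle have a `1 / √n` fraction of the cube. -/
theorem two_pow_le_choose (n v : ℕ) (d : ℝ) (hv : |(v : ℝ) - n / 2| ≤ d)
    (hd : 2 * (d + 1 / 2) ^ 2 ≤ (n - 1) / 2) (hn : 3 ≤ n) :
    (2 : ℝ) ^ n ≤ 4 * √n * n.choose v := by
  have hd0 : 0 ≤ d := le_trans (abs_nonneg _) hv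
  rw [abs_le] at hv
  obtain ⟨p, hp | hp⟩ := Nat.even_or_odd' n
  · subst hp
    push_cast at *
    have h := choose_two_mul_lower p v d (by omega) (by rw [abs_le]; constructor <;> linarith)
      (by nlinarith)
    rw [pow_mul]
    norm_num
    refine h.trans ?_
    have : √(p : ℝ) ≤ √2 * √p := by
      have : (1 : ℝ) ≤ √2 := by rw [Real.one_le_sqrt]; norm_num
      nlinarith [Real.sqrt_nonneg (p : ℝ)]
    gcongr
  · subst hp
    push_cast at *
    have hv1 : 1 ≤ v := by
      by_contra! h0
      have h0' : v = 0 := by omega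
      subst h0'
      have h1p : (1 : ℝ) ≤ p := by exact_mod_cast (by omega : 1 ≤ p)
      push_cast at hv
      nlinarith [hv.1]
    obtain ⟨u, rfl⟩ := Nat.exists_eq_add_of_le' hv1
    push_cast at hv
    -- Pascal's rule splits the level into levels `u` and `u + 1` of dimension `2p`. Both are within
    -- `d + 1/2` of `p`, which accounts for the shift in `hd`.
    have h1 := choose_two_mul_lower p (u + 1) (d + 1 / 2) (by omega)
      (by rw [abs_le]; push_cast; constructor <;> linarith) (by linarith)
    have h2 := choose_two_mul_lower p u (d + 1 / 2) (by omega)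
      (by rw [abs_le]; constructor <;> linarith) (by linarith)
    rw [Nat.choose_succ_succ]
    have e : (2 : ℝ) ^ (2 * p + 1) = 2 * 4 ^ p := by rw [pow_succ, pow_mul]; norm_num; ring
    rw [e]
    push_cast
    have h3 : √(p : ℝ) ≤ √(2 * (p : ℝ) + 1) := Real.sqrt_le_sqrt (by linarith [(Nat.cast_nonneg p : (0:ℝ) ≤ p)])
    have h4 : 4 * √(p : ℝ) * ((2 * p).choose u + (2 * p).choose (u + 1)) ≤
        4 * √(2 * (p : ℝ) + 1) * ((2 * p).choose u + (2 * p).choose (u + 1)) := by gcongr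
    linarith
/-! ### Chains and permutations -/

/-- The set of the first `t` coordinates in the order `σ`. -/
def initial {n : ℕ} (σ : Equiv.Perm (Fin n)) (t : ℕ) : Cube (Fin n) :=
  fun c => decide ((σ.symm c : ℕ) < t)

section
variable {n : ℕ}

theorem initial_apply (σ : Equiv.Perm (Fin n)) (t : ℕ) (c : Fin n) :
    initial σ t c = true ↔ (σ.symm c : ℕ) < t := by simp [initial]

theorem initial_mono (σ : Equiv.Perm (Fin n)) : Monotone (initial σ) := by
  intro s t hst c
  rw [Bool.le_iff_imp]
  simp only [initial_apply]
  omega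

theorem weightOn_mono {ι : Type} (S : Finset ι) : Monotone (weightOn S) := by
  intro x y hxy
  refine Finset.card_le_card fun i hi => ?_
  simp only [Finset.mem_filter] at hi ⊢
  exact ⟨hi.1, (Bool.le_iff_imp.1 (hxy i)) hi.2⟩

theorem weightOn_initial_succ (S : Finset (Fin n)) (σ : Equiv.Perm (Fin n)) (t : Fin n) :
    weightOn S (initial σ (t + 1)) =
      weightOn S (initial σ t) + if σ t ∈ S then 1 else 0 := by
  unfold weightOn
  have key : S.filter (fun i => initial σ (t + 1) i = true) =
      (S.filter fun i => initial σ t i = true) ∪ (S.filter fun i => i = σ t) := by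
    ext i
    simp only [Finset.mem_filter, Finset.mem_union, initial_apply]
    have : i = σ t ↔ (σ.symm i : ℕ) = t := by
      rw [← Equiv.symm_apply_eq, Fin.ext_iff]
    rw [this]
    constructor
    · rintro ⟨h, h2⟩
      rcases Nat.lt_succ_iff_lt_or_eq.1 h2 with h3 | h3
      · exact Or.inl ⟨h, h3⟩
      · exact Or.inr ⟨h, h3⟩
    · rintro (⟨h, h2⟩ | ⟨h, h2⟩)
      · exact ⟨h, by omega⟩
      · exact ⟨h, by omega⟩
  rw [key, Finset.card_union_of_disjoint]
  · congr 1
    rw [Finset.filter_eq']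
    split_ifs <;> simp
  · rw [Finset.disjoint_left]
    intro i hi hi2
    simp only [Finset.mem_filter, initial_apply] at hi hi2
    rw [hi2.2] at hi
    simp at hi

theorem weight_initial (σ : Equiv.Perm (Fin n)) (t : ℕ) (ht : t ≤ n) :
    weight (initial σ t) = t := by
  induction t with
  | zero => simp [weight, weightOn, initial]
  | succ t ih =>
    have := weightOn_initial_succ Finset.univ σ ⟨t, by omega⟩
    simp only [Finset.mem_univ, if_true] at this
    rw [weight, this]
    have := ih (by omega)
    rw [weight] at this
    rw [this]

theorem initial_strictMonoOn (σ : Equiv.Perm (Fin n)) {s t : ℕ} (hst : s < t) (ht : t ≤ n) :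
    initial σ s < initial σ t := by
  refine lt_of_le_of_ne (initial_mono σ hst.le) fun h => ?_
  have h1 := weight_initial σ s (by omega)
  have h2 := weight_initial σ t ht
  rw [h] at h1
  omega

/-- The permutation on the left is `σ * swap s u`: exchanging two steps that are not among the first
`t` leaves the first `t` steps alone. -/
theorem initial_swap (σ : Equiv.Perm (Fin n)) (s u : Fin n) {t : ℕ} (hs : t ≤ s) (hu : t ≤ u) :
    initial (Equiv.swap s u * σ.symm).symm t = initial σ t := by
  funext c
  rw [Bool.eq_iff_iff]
  simp only [initial_apply, Equiv.symm_symm, Equiv.Perm.coe_mul, Function.comp_apply]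
  rcases eq_or_ne (σ.symm c) s with h | h
  · rw [h, Equiv.swap_apply_left]; omega
  rcases eq_or_ne (σ.symm c) u with h' | h'
  · rw [h', Equiv.swap_apply_right]; omega
  rw [Equiv.swap_apply_of_ne_of_ne h h']

/-- A product of step weights along a random chain has mean at most one, if the step weights
have mean at most one at every point. -/
theorem sum_prod_step_le (φ : Cube (Fin n) → Fin n → ℝ) (h0 : ∀ z c, 0 ≤ φ z c)
    (hφ : ∀ z, ∑ c ∈ Finset.univ.filter (fun c => z c = false), φ z c ≤
      (Finset.univ.filter (fun c => z c = false)).card) :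
    ∑ σ : Equiv.Perm (Fin n), ∏ t : Fin n, φ (initial σ t) (σ t) ≤ n.factorial := by
  have key : ∀ t : ℕ, t ≤ n → ∑ σ : Equiv.Perm (Fin n),
      ∏ i ∈ Finset.univ.filter (fun i : Fin n => (i : ℕ) < t), φ (initial σ i) (σ i) ≤
        n.factorial := by
    intro t ht
    induction t with
    | zero => simp [Fintype.card_perm]
    | succ t ih =>
      refine le_trans ?_ (ih (by omega))
      set T : Fin n := ⟨t, by omega⟩ with hT
      have hfil : Finset.univ.filter (fun i : Fin n => (i : ℕ) < t + 1) =
          insert T (Finset.univ.filter (fun i : Fin n => (i : ℕ) < t)) := by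
        ext i
        simp only [Finset.mem_filter, Finset.mem_univ, true_and, Finset.mem_insert, Fin.ext_iff, hT]
        omega
      have hnot : T ∉ Finset.univ.filter (fun i : Fin n => (i : ℕ) < t) := by simp [hT]
      set P : Equiv.Perm (Fin n) → ℝ := fun σ =>
        ∏ i ∈ Finset.univ.filter (fun i : Fin n => (i : ℕ) < t), φ (initial σ i) (σ i) with hP
      have hP0 : ∀ σ, 0 ≤ P σ := fun σ => Finset.prod_nonneg fun i _ => h0 _ _
      simp only [hfil, Finset.prod_insert hnot]
      change ∑ σ, φ (initial σ t) (σ T) * P σ ≤ ∑ σ, P σ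
      -- Given the first `t` steps, the next coordinate is uniform among the unset ones.
      -- Transpositions with the steps in `U` express this without conditional expectations.
      set U : Finset (Fin n) := Finset.univ.filter (fun i : Fin n => t ≤ (i : ℕ)) with hU
      have hUT : T ∈ U := by simp [hU, hT]
      have hUpos : (0 : ℝ) < U.card := by exact_mod_cast Finset.card_pos.2 ⟨T, hUT⟩
      -- transposing the step `t` with a later step
      have hswap : ∀ u ∈ U, ∑ σ, φ (initial σ t) (σ T) * P σ =
          ∑ σ, φ (initial σ t) (σ u) * P σ := by
        intro u hu
        have hu' : t ≤ (u : ℕ) := by simpa [hU] using hu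
        rw [← Equiv.sum_comp (Equiv.mulRight (Equiv.swap T u))]
        refine Finset.sum_congr rfl fun σ _ => ?_
        have hinit : ∀ s ≤ t, initial (σ * Equiv.swap T u) s = initial σ s := by
          intro s hs
          have := initial_swap σ T u (t := s) (by simpa [hT] using hs) (by omega)
          rw [← this]
          congr 1
        simp only [Equiv.coe_mulRight]
        rw [hinit t le_rfl]
        congr 1
        · simp
        · refine Finset.prod_congr rfl fun i hi => ?_
          simp only [Finset.mem_filter, Finset.mem_univ, true_and] at hi
          rw [hinit i hi.le]
          congr 1
          simp only [Equiv.Perm.coe_mul, Function.comp_apply]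
          rw [Equiv.swap_apply_of_ne_of_ne]
          · intro h; rw [h] at hi; simp [hT] at hi
          · intro h; rw [h] at hi; omega
      have hsum : (U.card : ℝ) * ∑ σ, φ (initial σ t) (σ T) * P σ ≤ U.card * ∑ σ, P σ := by
        calc (U.card : ℝ) * ∑ σ, φ (initial σ t) (σ T) * P σ
            = ∑ u ∈ U, ∑ σ, φ (initial σ t) (σ u) * P σ := by
              rw [← Finset.sum_congr rfl hswap, Finset.sum_const, nsmul_eq_mul]
          _ = ∑ σ, (∑ u ∈ U, φ (initial σ t) (σ u)) * P σ := by
              rw [Finset.sum_comm]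
              simp only [Finset.sum_mul]
          _ ≤ ∑ σ, (U.card : ℝ) * P σ := by
              refine Finset.sum_le_sum fun σ _ => mul_le_mul_of_nonneg_right ?_ (hP0 σ)
              -- The steps not yet made are those that set the unset coordinates, so `hφ` at the
              -- current point applies.
              have himg : U.map σ.toEmbedding =
                  Finset.univ.filter (fun c => initial σ t c = false) := by
                ext c
                simp only [Finset.mem_map_equiv, Finset.mem_filter, Finset.mem_univ, true_and,
                  ← Bool.not_eq_true, initial_apply, hU]
                omega
              have := hφ (initial σ t)
              rw [← himg, Finset.sum_map, Finset.card_map] at this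
              simpa using this
          _ = _ := by rw [Finset.mul_sum]
      exact le_of_mul_le_mul_left hsum hUpos
  have := key n le_rfl
  have hf : Finset.univ.filter (fun i : Fin n => (i : ℕ) < n) = Finset.univ := by
    ext i; simp
  rwa [hf] at this

/-- Tail bound for the number of relevant steps that a random chain makes while its weight
on `L` is in `[lo, hi]`. -/
theorem card_relevant_steps_le (L : Finset (Fin n)) (rel : Cube (Fin n) → Finset (Fin n))
    (hdisj : ∀ z, Disjoint (rel z) L) (θ : ℝ) (hθ0 : 0 ≤ θ) (hθ : θ ≤ 1 / 2) (lo hi D : ℕ)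
    (hrel : ∀ z, lo ≤ weightOn L z → weightOn L z ≤ hi →
      (((rel z).filter fun c => z c = false).card : ℝ) ≤
        θ * (L.filter fun c => z c = false).card) :
    ((Finset.univ.filter fun σ : Equiv.Perm (Fin n) =>
      D ≤ (Finset.univ.filter fun t : Fin n => (lo ≤ weightOn L (initial σ t) ∧
        weightOn L (initial σ t) ≤ hi) ∧ σ t ∈ rel (initial σ t)).card).card : ℝ) *
      (2 ^ D * (1 - θ) ^ (hi + 1 - lo)) ≤ n.factorial := by
  classical
  set win : Cube (Fin n) → Prop := fun z => lo ≤ weightOn L z ∧ weightOn L z ≤ hi with hwin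
  -- Inside the window a relevant step counts `2` and a step in `L` counts `1 - θ`. By `hrel` the
  -- mean is at most one, so Markov's inequality for the product gives the tail bound.
  set φ : Cube (Fin n) → Fin n → ℝ := fun z c =>
    (if win z ∧ c ∈ rel z then 2 else 1) * (if win z ∧ c ∈ L then 1 - θ else 1) with hφ
  have h1 : 0 ≤ 1 - θ := by linarith
  have hφ0 : ∀ z c, 0 ≤ φ z c := by
    intro z c
    simp only [hφ]
    split_ifs <;> nlinarith
  have hmean : ∀ z, ∑ c ∈ Finset.univ.filter (fun c => z c = false), φ z c ≤
      (Finset.univ.filter (fun c => z c = false)).card := by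
    intro z
    by_cases hz : win z
    · have : ∀ c, φ z c = 1 + (if c ∈ rel z then 1 else 0) - θ * (if c ∈ L then 1 else 0) := by
        intro c
        simp only [hφ, hz, true_and]
        by_cases h2 : c ∈ rel z
        · have h3 : c ∉ L := Finset.disjoint_left.1 (hdisj z) h2
          simp only [h2, h3, if_true, if_false]; norm_num
        · simp only [h2, if_false]
          split_ifs <;> ring
      simp only [this, Finset.sum_sub_distrib, Finset.sum_add_distrib, ← Finset.mul_sum]
      have e : ∀ S : Finset (Fin n), ∑ c ∈ Finset.univ.filter (fun c => z c = false),
          (if c ∈ S then (1 : ℝ) else 0) = (S.filter fun c => z c = false).card := by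
        intro S
        rw [Finset.sum_ite_mem, Finset.sum_const, nsmul_eq_mul, mul_one]
        congr 2
        ext c
        simp [and_comm]
      rw [e, e]
      have := hrel z hz.1 hz.2
      simp only [Finset.sum_const, nsmul_eq_mul, mul_one]
      linarith
    · have : ∀ c, φ z c = 1 := by intro c; simp [hφ, hz]
      simp [this]
  have hmain := sum_prod_step_le φ hφ0 hmean
  refine le_trans ?_ hmain
  rw [← nsmul_eq_mul, ← Finset.sum_const]
  refine le_trans (Finset.sum_le_sum fun σ hσ => ?_)
    (Finset.sum_le_sum_of_subset_of_nonneg (Finset.filter_subset _ _)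
      fun σ _ _ => Finset.prod_nonneg fun t _ => hφ0 _ _)
  simp only [Finset.mem_filter, Finset.mem_univ, true_and] at hσ
  have hprod : ∀ (p : Fin n → Prop) [DecidablePred p] (x : ℝ), ∏ t, (if p t then x else 1) =
      x ^ (Finset.univ.filter p).card := by
    intro p _ x
    rw [Finset.prod_ite]
    simp
  simp only [hφ, Finset.prod_mul_distrib]
  rw [hprod, hprod]
  -- Each step in `L` raises the weight on `L`, so such steps inside the window start from different
  -- weights in `[lo, hi]`.
  have hL : (Finset.univ.filter fun t : Fin n => win (initial σ t) ∧ σ t ∈ L).card ≤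
      hi + 1 - lo := by
    rw [← Nat.card_Icc]
    refine Finset.card_le_card_of_injOn (fun t => weightOn L (initial σ t)) ?_ ?_
    · intro t ht
      simp only [Finset.coe_filter, Finset.mem_univ, true_and, Set.mem_ofPred_eq] at ht
      simpa using ht.1
    · have hlt : ∀ s t : Fin n, s < t → σ s ∈ L →
          weightOn L (initial σ s) < weightOn L (initial σ t) := by
        intro s t hst hs
        have h3 := weightOn_initial_succ L σ s
        rw [if_pos hs] at h3
        have h4 : weightOn L (initial σ (s + 1)) ≤ weightOn L (initial σ t) :=
          weightOn_mono L (initial_mono σ (by omega))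
        omega
      intro s hs t ht hst
      simp only [Finset.coe_filter, Finset.mem_univ, true_and, Set.mem_ofPred_eq] at hs ht hst
      rcases lt_trichotomy s t with h | h | h
      · exact absurd hst (hlt s t h hs.2).ne
      · exact h
      · exact absurd hst (hlt t s h ht.2).ne'
  refine mul_le_mul ?_ ?_ (pow_nonneg h1 _) (by positivity)
  · exact pow_le_pow_right₀ (by norm_num) hσ
  · exact pow_le_pow_of_le_one h1 (by linarith) hL

/-! ### Maximal chains correspond to permutations -/

theorem isFullChain_initial (σ : Equiv.Perm (Fin n)) :
    IsFullChain fun t : Fin (n + 1) => initial σ t := by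
  refine ⟨fun s t hst => initial_strictMonoOn σ hst (by omega), ?_, ?_⟩
  · funext c; simp [initial]
  · funext c; simp [initial]

theorem initial_injective :
    Function.Injective fun (σ : Equiv.Perm (Fin n)) (t : Fin (n + 1)) => initial σ t := by
  intro σ τ h
  rw [← Equiv.symm_bijective.injective.eq_iff]
  ext c
  have key : ∀ t : ℕ, t ≤ n → (((σ.symm c : ℕ) < t) ↔ (τ.symm c : ℕ) < t) := by
    intro t ht
    have := congrFun (congrFun h ⟨t, by omega⟩) c
    rw [Bool.eq_iff_iff] at this
    simpa only [initial_apply] using this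
  have h1 := key (σ.symm c) (by omega)
  have h2 := key (τ.symm c) (by omega)
  have h3 := key (σ.symm c + 1) (by omega)
  have h4 := key (τ.symm c + 1) (by omega)
  omega

theorem weight_lt_of_lt {ι : Type} [Fintype ι] {x y : Cube ι} (h : x < y) :
    weight x < weight y := by
  obtain ⟨h1, i, hi⟩ := Pi.lt_def.1 h
  refine Finset.card_lt_card ⟨fun j hj => ?_, fun hsub => ?_⟩
  · simp only [Finset.mem_filter] at hj ⊢
    exact ⟨hj.1, Bool.le_iff_imp.1 (h1 j) hj.2⟩
  · have hy : y i = true := by revert hi; cases x i <;> cases y i <;> simp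
    have hx : x i = false := by revert hi; cases x i <;> cases y i <;> simp
    have := hsub (by simpa using hy : i ∈ Finset.univ.filter fun j => y j = true)
    simp [hx] at this

theorem IsFullChain.weight_eq {Z : Fin (n + 1) → Cube (Fin n)} (hZ : IsFullChain Z)
    (t : Fin (n + 1)) : weight (Z t) = t := by
  have hle : ∀ x : Cube (Fin n), weight x ≤ n := fun x =>
    (Finset.card_filter_le _ _).trans_eq (Finset.card_fin n)
  set w : Fin (n + 1) → Fin (n + 1) := fun t => ⟨weight (Z t), by have := hle (Z t); omega⟩
  have hw : StrictMono w := fun s t hst => weight_lt_of_lt (hZ.1 hst)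
  have h := hw.range_inj (g := id) strictMono_id |>.1 (by
    rw [Set.range_id]
    exact (Finite.injective_iff_surjective.1 hw.injective).range_eq)
  have := congrFun h t
  simpa [w, Fin.ext_iff] using this

/-- Each of the `n` steps sets at least one new coordinate. Choosing one for each step gives an
injection, hence a permutation, and nothing is left over. -/
theorem IsFullChain.exists_perm {Z : Fin (n + 1) → Cube (Fin n)} (hZ : IsFullChain Z) :
    ∃ σ : Equiv.Perm (Fin n), (fun t : Fin (n + 1) => initial σ t) = Z := by
  classical
  have hnew : ∀ t : Fin n, ∃ c : Fin n, Z t.castSucc c = false ∧ Z t.succ c = true := by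
    intro t
    obtain ⟨h1, i, hi⟩ := Pi.lt_def.1 (hZ.1 (Fin.castSucc_lt_succ (i := t)))
    exact ⟨i, by revert hi; cases Z t.castSucc i <;> cases Z t.succ i <;> simp⟩
  choose σ hσ using hnew
  have hinj : Function.Injective σ := by
    have hne : ∀ s t : Fin n, s < t → σ s ≠ σ t := by
      intro s t hst h
      have h1 := (hσ s).2
      have h2 := (hσ t).1
      have h3 : Z s.succ ≤ Z t.castSucc := hZ.1.monotone (by
        rw [Fin.le_def]; simpa using hst)
      have := Bool.le_iff_imp.1 (h3 (σ s)) h1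
      rw [h, h2] at this
      exact absurd this (by simp)
    intro s t h
    rcases lt_trichotomy s t with h' | h' | h'
    · exact absurd h (hne s t h')
    · exact h'
    · exact absurd h.symm (hne t s h')
  have hbij := Finite.injective_iff_bijective.1 hinj
  refine ⟨Equiv.ofBijective σ hbij, ?_⟩
  funext t c
  obtain ⟨s, rfl⟩ := hbij.surjective c
  rw [Bool.eq_iff_iff, initial_apply]
  have : (Equiv.ofBijective σ hbij).symm (σ s) = s := by
    rw [Equiv.symm_apply_eq]; rfl
  rw [this]
  constructor
  · intro h
    have h3 : Z s.succ ≤ Z t := hZ.1.monotone (by rw [Fin.le_def]; simp; omega)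
    exact Bool.le_iff_imp.1 (h3 _) (hσ s).2
  · intro h
    by_contra! h'
    have h3 : Z t ≤ Z s.castSucc := hZ.1.monotone (by rw [Fin.le_def]; simpa using h')
    have := Bool.le_iff_imp.1 (h3 _) h
    rw [(hσ s).1] at this
    exact absurd this (by simp)

open Classical in
theorem detectionProb_eq (k : ℕ) (f : BoolFn n) :
    detectionProb k f = ((Finset.univ.filter fun σ : Equiv.Perm (Fin n) =>
      Detects k f fun t : Fin (n + 1) => initial σ t).card : ℝ) / n.factorial := by
  unfold detectionProb
  have himg : ∀ P : (Fin (n + 1) → Cube (Fin n)) → Prop,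
      (Finset.univ.filter fun Z : Fin (n + 1) → Cube (Fin n) => IsFullChain Z ∧ P Z).card =
      (Finset.univ.filter fun σ : Equiv.Perm (Fin n) => P fun t : Fin (n + 1) => initial σ t).card := by
    intro P
    rw [← Finset.card_image_of_injective _ (initial_injective (n := n))]
    congr 1
    ext Z
    simp only [Finset.mem_filter, Finset.mem_univ, true_and, Finset.mem_image]
    constructor
    · rintro ⟨h1, h2⟩
      obtain ⟨σ, rfl⟩ := h1.exists_perm
      exact ⟨σ, h2, rfl⟩
    · rintro ⟨σ, h, rfl⟩
      exact ⟨isFullChain_initial σ, h⟩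
  congr 1
  · rw [himg]
  · have := himg fun _ => True
    simp only [and_true, Finset.filter_true] at this
    rw [this, Finset.card_univ, Fintype.card_perm, Fintype.card_fin]

/-! ### Averages over levels -/

/-- The points of weight `w`. -/
def level (n w : ℕ) : Finset (Cube (Fin n)) := Finset.univ.filter fun z => weight z = w

theorem mem_level {w : ℕ} {z : Cube (Fin n)} : z ∈ level n w ↔ weight z = w := by simp [level]

theorem card_level (n w : ℕ) : (level n w).card = n.choose w := by
  have h := Finset.card_powersetCard w (Finset.univ : Finset (Fin n))
  rw [Finset.card_univ, Fintype.card_fin] at h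
  rw [← h]
  refine Finset.card_bij (fun z _ => Finset.univ.filter fun i => z i = true) ?_ ?_ ?_
  · intro z hz
    rw [mem_level] at hz
    simpa [Finset.mem_powersetCard, weight, weightOn] using hz
  · intro z _ z' _ h
    funext i
    have := congrArg (fun s => i ∈ s) h
    simp only [Finset.mem_filter, Finset.mem_univ, true_and, eq_iff_iff] at this
    exact Bool.eq_iff_iff.2 this
  · intro s hs
    refine ⟨fun i => decide (i ∈ s), ?_, by simp⟩
    rw [mem_level]
    simpa [Finset.mem_powersetCard, weight, weightOn] using hs

/-- Left multiplication by a permutation of the coordinates that carries `z` to `z'` matches the two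
sets of orders. -/
theorem card_perm_initial_eq {w : ℕ} {z z' : Cube (Fin n)} (h : weight z = weight z') :
    (Finset.univ.filter fun σ : Equiv.Perm (Fin n) => initial σ w = z).card =
      (Finset.univ.filter fun σ : Equiv.Perm (Fin n) => initial σ w = z').card := by
  classical
  have hc : Fintype.card {i // z i = true} = Fintype.card {i // z' i = true} := by
    simpa [Fintype.card_subtype, weight, weightOn] using h
  obtain ⟨π, hπ⟩ : ∃ π : Equiv.Perm (Fin n), ∀ i, z' (π i) = z i := by
    have e := Fintype.equivOfCardEq hc
    refine ⟨e.extendSubtype, fun i => ?_⟩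
    rw [Bool.eq_iff_iff]
    constructor
    · intro h1
      by_contra h2
      exact e.extendSubtype_not_mem i h2 h1
    · intro h1
      exact e.extendSubtype_mem i h1
  refine Finset.card_bij (fun σ _ => π * σ) ?_ ?_ ?_
  · intro σ hσ
    simp only [Finset.mem_filter, Finset.mem_univ, true_and] at hσ ⊢
    funext c
    rw [← π.apply_symm_apply c, hπ, ← hσ]
    simp [initial, Equiv.Perm.mul_def]
  · intro σ _ τ _ h
    simpa using h
  · intro τ hτ
    refine ⟨π⁻¹ * τ, ?_, by simp⟩
    simp only [Finset.mem_filter, Finset.mem_univ, true_and] at hτ ⊢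
    funext c
    rw [← hπ, ← hτ]
    simp [initial, Equiv.Perm.mul_def, Equiv.Perm.inv_def]
    rfl

/-- The `w`-th point of a random chain is uniformly distributed on its level. -/
theorem sum_level_eq (a : Cube (Fin n) → ℝ) {w : ℕ} (hw : w ≤ n) :
    (n.factorial : ℝ) * ∑ z ∈ level n w, a z =
      n.choose w * ∑ σ : Equiv.Perm (Fin n), a (initial σ w) := by
  classical
  have hfib : ∀ b : Cube (Fin n) → ℝ, ∑ σ : Equiv.Perm (Fin n), b (initial σ w) =
      ∑ z ∈ level n w, ((Finset.univ.filter fun σ : Equiv.Perm (Fin n) =>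
        initial σ w = z).card : ℝ) * b z := by
    intro b
    rw [← Finset.sum_fiberwise_of_maps_to (s := Finset.univ) (t := level n w)
      (g := fun σ : Equiv.Perm (Fin n) => initial σ w)
      (fun σ _ => mem_level.2 (weight_initial σ w hw))]
    refine Finset.sum_congr rfl fun z _ => ?_
    rw [Finset.sum_congr rfl (g := fun _ => b z), Finset.sum_const, nsmul_eq_mul]
    intro σ hσ
    simp only [Finset.mem_filter] at hσ
    rw [hσ.2]
  obtain ⟨z₀, hz₀⟩ : (level n w).Nonempty := by
    rw [← Finset.card_pos, card_level]
    exact Nat.choose_pos hw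
  set N := (Finset.univ.filter fun σ : Equiv.Perm (Fin n) => initial σ w = z₀).card with hN
  have hcard : ∀ z ∈ level n w,
      (Finset.univ.filter fun σ : Equiv.Perm (Fin n) => initial σ w = z).card = N := by
    intro z hz
    exact card_perm_initial_eq ((mem_level.1 hz).trans (mem_level.1 hz₀).symm)
  have hfib' : ∀ b : Cube (Fin n) → ℝ, ∑ σ : Equiv.Perm (Fin n), b (initial σ w) =
      N * ∑ z ∈ level n w, b z := by
    intro b
    rw [hfib, Finset.mul_sum]
    exact Finset.sum_congr rfl fun z hz => by rw [hcard z hz]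
  -- The constant function determines the common fibre size `N`.
  have h1 := hfib' fun _ => 1
  have h2 := hfib' a
  simp only [Finset.sum_const, nsmul_eq_mul, mul_one, Finset.card_univ, Fintype.card_perm,
    Fintype.card_fin, card_level] at h1
  rw [h1, h2]
  ring

end
/-! ### Monotone functions as parities of ranks -/

/-- There are `j` points below `z`, increasing, on which `h` alternates starting with `1`. -/
def HasAlternation {n : ℕ} (h : BoolFn n) (z : Cube (Fin n)) (j : ℕ) : Prop :=
  ∃ x : ℕ → Cube (Fin n), (∀ i, i + 1 < j → x i < x (i + 1)) ∧
    ∀ i < j, x i ≤ z ∧ (h (x i) = true ↔ Even i)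

theorem not_hasAlternation {n g : ℕ} {h : BoolFn n} (hh : h ∈ kMonotone n g) (z : Cube (Fin n)) :
    ¬ HasAlternation h z (g + 1) := by
  rintro ⟨x, hx, hx2⟩
  refine hh ⟨fun i => x i, ?_, ?_, ?_⟩
  · rw [Fin.strictMono_iff_lt_succ]
    intro i
    simpa using hx i (by omega)
  · simpa using (hx2 0 (by omega)).2
  · intro j hj
    have h1 := (hx2 j (by omega)).2
    have h2 := (hx2 (j + 1) (by omega)).2
    simp only [Fin.val_castSucc, Fin.val_succ] at hj
    rw [hj, h2, Nat.even_add_one] at h1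
    tauto

/-- A `g`-monotone function is the parity of a monotone function with values in `{0, …, g}`. -/
theorem exists_rank {n g : ℕ} {h : BoolFn n} (hh : h ∈ kMonotone n g) :
    ∃ A : Cube (Fin n) → ℕ, Monotone A ∧ (∀ z, A z ≤ g) ∧ ∀ z, h z = true ↔ Odd (A z) := by
  classical
  have hmon : ∀ {z z'}, z ≤ z' → ∀ {j}, HasAlternation h z j → HasAlternation h z' j := by
    rintro z z' hz j ⟨x, hx, hx2⟩
    exact ⟨x, hx, fun i hi => ⟨(hx2 i hi).1.trans hz, (hx2 i hi).2⟩⟩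
  have h0 : ∀ z, HasAlternation h z 0 := fun z => ⟨fun _ => z, by omega, by omega⟩
  -- The rank is the length of the longest alternation below `z`. The cap at `g` loses nothing, by
  -- `not_hasAlternation`.
  set A : Cube (Fin n) → ℕ := fun z => Nat.findGreatest (HasAlternation h z) g with hA
  have hspec : ∀ z, HasAlternation h z (A z) := fun z =>
    Nat.findGreatest_spec (P := HasAlternation h z) (Nat.zero_le g) (h0 z)
  refine ⟨A, fun z z' hz => ?_, fun z => Nat.findGreatest_le g, fun z => ?_⟩
  · exact Nat.le_findGreatest (Nat.findGreatest_le g) (hmon hz (hspec z))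
  · by_contra hcon
    have hz : h z = true ↔ Even (A z) := by
      rw [← Nat.not_odd_iff_even]; tauto
    obtain ⟨x, hx, hx2⟩ := hspec z
    -- If the parity of `A z` were wrong, `z` itself would prolong a longest alternation. It differs
    -- from the last point because `h` does.
    have hext : HasAlternation h z (A z + 1) := by
      refine ⟨fun i => if i < A z then x i else z, fun i hi => ?_, fun i hi => ?_⟩ <;> beta_reduce
      · have hi1 : i < A z := by omega
        rw [if_pos hi1]
        split_ifs with h2
        · exact hx i h2
        · have hi' : A z = i + 1 := by omega
          refine lt_of_le_of_ne (hx2 i hi1).1 fun heq => ?_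
          have := (hx2 i hi1).2
          rw [heq, hz, hi', Nat.even_add_one] at this
          tauto
      · split_ifs with h2
        · exact hx2 i h2
        · have : i = A z := by omega
          subst this
          exact ⟨le_rfl, hz⟩
    rcases Nat.lt_or_ge (A z) g with hlt | hge
    · exact Nat.findGreatest_is_greatest (P := HasAlternation h z) (Nat.lt_succ_self _)
        (Nat.succ_le_of_lt hlt) hext
    · have : A z = g := le_antisymm (Nat.findGreatest_le g) hge
      rw [this] at hext
      exact not_hasAlternation hh z hext
/-! ### Functions hidden in a window -/

/-- `G`, on the coordinates `κ`, is revealed when the weight on the other coordinates is in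
`[lo, hi]`. -/
def hide {κ : Type} {l n : ℕ} (e : κ ⊕ Fin l ≃ Fin n) (k lo hi : ℕ) (G : Cube κ → Bool) :
    BoolFn n := fun z =>
  if weight (fun i : Fin l => z (e (.inr i))) < lo then false
  else if weight (fun i : Fin l => z (e (.inr i))) ≤ hi then G fun i => z (e (.inl i))
  else decide (Odd k)

/-- Permuting coordinates only changes the identification `e`, so bounds that hold for every `e`
hold on the whole orbit. -/
theorem mem_coordOrbit_hide {κ : Type} {l n k lo hi : ℕ} {e : κ ⊕ Fin l ≃ Fin n}
    {G : Cube κ → Bool} {h : BoolFn n} (hh : h ∈ coordOrbit (hide e k lo hi G)) :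
    ∃ e' : κ ⊕ Fin l ≃ Fin n, h = hide e' k lo hi G := by
  obtain ⟨σ, rfl⟩ := hh
  exact ⟨e.trans σ, rfl⟩

/-- `G` differs from the parity of `a` at `y`. -/
def Mismatch {κ : Type} (G : Cube κ → Bool) (a : Cube κ → ℕ) (y : Cube κ) : Prop :=
  ¬ (G y = true ↔ Odd (a y))

instance {κ : Type} (G : Cube κ → Bool) (a : Cube κ → ℕ) : DecidablePred (Mismatch G a) :=
  fun y => inferInstanceAs (Decidable (¬ (G y = true ↔ Odd (a y))))

/-- `G` disagrees with every parity of a monotone function with values in `{0, …, g}` on a `δ`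
fraction of the points. -/
def FarFromRanks {κ : Type} [Fintype κ] [DecidableEq κ] (δ : ℝ) (g : ℕ) (G : Cube κ → Bool) :
    Prop :=
  ∀ a : Cube κ → ℕ, Monotone a → (∀ y, a y ≤ g) →
    δ * 2 ^ Fintype.card κ ≤
      ((Finset.univ.filter (Mismatch G a)).card : ℝ)

/-- On each slice with a fixed window point `x`, the rank of a `g`-monotone function is still
monotone and bounded by `g`, so `hG` gives a `δ` fraction of mismatches. The window slices make up a
`c` fraction of the cube. -/
theorem isFar_hide {κ : Type} [Fintype κ] [DecidableEq κ] {l n k lo hi g : ℕ}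
    (e : κ ⊕ Fin l ≃ Fin n) {G : Cube κ → Bool} {δ c : ℝ} (hδ : 0 ≤ δ) (hG : FarFromRanks δ g G)
    (hc : c * 2 ^ l ≤ ((Finset.univ.filter fun x : Cube (Fin l) =>
      lo ≤ weight x ∧ weight x ≤ hi).card : ℝ)) :
    IsFar (c * δ) (hide e k lo hi G) (kMonotone n g) := by
  intro h hh
  obtain ⟨A, hA, hAg, hAh⟩ := exists_rank hh
  set mk : Cube (Fin l) → Cube κ → Cube (Fin n) := fun x y i => Sum.elim y x (e.symm i) with hmk
  set mis : Cube (Fin l) → Finset (Cube κ) := fun x =>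
    Finset.univ.filter (Mismatch G fun y => A (mk x y))
  set win := Finset.univ.filter fun x : Cube (Fin l) => lo ≤ weight x ∧ weight x ≤ hi
  have h1 : ((win.sigma mis).card : ℝ) ≤
      ((Finset.univ.filter fun z => hide e k lo hi G z ≠ h z).card : ℝ) := by
    refine Nat.cast_le.2 (Finset.card_le_card_of_injOn (fun p => mk p.1 p.2) ?_ ?_)
    · rintro ⟨x, y⟩ hp
      simp only [Finset.coe_sigma, Set.mem_sigma_iff, SetLike.mem_coe, Finset.mem_filter,
        Finset.mem_univ, true_and, win, mis, Mismatch] at hp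
      simp only [Finset.coe_filter, Finset.mem_univ, true_and, Set.mem_ofPred_eq]
      intro heq
      apply hp.2
      rw [← hAh, ← heq]
      simp [hide, hmk, hp.1.1, hp.1.2]
    · rintro ⟨x, y⟩ - ⟨x', y'⟩ - heq
      have h2 : ∀ s : κ ⊕ Fin l, Sum.elim y x s = Sum.elim y' x' s := by
        intro s
        have := congrFun heq (e s)
        simpa [hmk] using this
      have h3 : x = x' := funext fun i => h2 (.inr i)
      have h4 : y = y' := funext fun i => h2 (.inl i)
      rw [h3, h4]
  have h2 : ∀ x, δ * 2 ^ Fintype.card κ ≤ ((mis x).card : ℝ) := by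
    intro x
    refine hG (fun y => A (mk x y)) (fun y y' hy => hA fun i => ?_) fun y => hAg _
    simp only [hmk]
    rcases e.symm i with j | j
    · exact hy j
    · exact le_rfl
  have hn : Fintype.card κ + l = n := by
    simpa using Fintype.card_congr e
  unfold hammingFrac
  rw [le_div_iff₀ (by positivity)]
  refine le_trans ?_ h1
  rw [Finset.card_sigma]
  push_cast
  calc c * δ * 2 ^ n = (c * 2 ^ l) * (δ * 2 ^ Fintype.card κ) := by rw [← hn, pow_add]; ring
    _ ≤ win.card * (δ * 2 ^ Fintype.card κ) := by gcongr
    _ = ∑ x ∈ win, δ * 2 ^ Fintype.card κ := by rw [Finset.sum_const, nsmul_eq_mul]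
    _ ≤ _ := Finset.sum_le_sum fun x _ => h2 x

/-! ### Detection forces relevant steps -/

/-- A path in the cube on which `G` alternates `k` times, starting with `1`, makes at least `D`
relevant steps. -/
def ForcesSteps {κ : Type} [DecidableEq κ] (G : Cube κ → Bool) (rel : Cube κ → Finset κ)
    (k D : ℕ) : Prop :=
  ∀ (Y : ℕ → Cube κ) (S : Finset ℕ),
    (∀ s, Y (s + 1) = Y s ∨ ∃ c, Y s c = false ∧ Y (s + 1) = Function.update (Y s) c true ∧
      (c ∈ rel (Y s) → s ∈ S)) →
    ∀ t : ℕ → ℕ, (∀ j < k, t j < t (j + 1)) → (∀ j ≤ k, (G (Y (t j)) = true ↔ Even j)) →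
      D ≤ ((Finset.Ico (t 0) (t k)).filter (· ∈ S)).card

/-- In `ForcesSteps` a path has a point for every natural number; a chain is prolonged past time `n`
by resting at the top. -/
theorem initial_of_le {n : ℕ} (σ : Equiv.Perm (Fin n)) {s : ℕ} (hs : n ≤ s) :
    initial σ s = fun _ => true := by
  funext c
  rw [initial_apply]
  omega

theorem initial_succ {n : ℕ} (σ : Equiv.Perm (Fin n)) (s : Fin n) :
    initial σ (s + 1) = Function.update (initial σ s) (σ s) true := by
  funext c
  rw [Bool.eq_iff_iff, initial_apply]
  rcases eq_or_ne c (σ s) with h | h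
  · simp [h]
  · rw [Function.update_of_ne h, initial_apply]
    have : (σ.symm c : ℕ) ≠ s := by
      intro h2
      exact h ((Equiv.symm_apply_eq σ).1 (Fin.ext h2))
    omega

theorem initial_self {n : ℕ} (σ : Equiv.Perm (Fin n)) (s : Fin n) :
    initial σ s (σ s) = false := by
  rw [← Bool.not_eq_true, initial_apply]; simp

/-- A detected violation lies in the window and projects to an alternation of `G`, which costs `D`
relevant steps there. At weight at most `hi` at least `l - hi` coordinates of `L` are unset, so
`hhi` supplies the ratio `θ`. -/
theorem detectionProb_hide_le {κ : Type} [Fintype κ] [DecidableEq κ] {l n k lo hi D M : ℕ}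
    (e : κ ⊕ Fin l ≃ Fin n) {G : Cube κ → Bool} (rel : Cube κ → Finset κ)
    (hM : ∀ y, (rel y).card ≤ M) (hG : ForcesSteps G rel k D) (θ : ℝ) (hθ0 : 0 ≤ θ)
    (hθ : θ ≤ 1 / 2) (hhi : (M : ℝ) ≤ θ * (l - hi)) :
    detectionProb k (hide e k lo hi G) * (2 ^ D * (1 - θ) ^ (hi + 1 - lo)) ≤ 1 := by
  classical
  set inl : κ ↪ Fin n := ⟨fun i => e (.inl i), fun i j h => by simpa using h⟩ with hinl
  set inr : Fin l ↪ Fin n := ⟨fun i => e (.inr i), fun i j h => by simpa using h⟩ with hinr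
  set L : Finset (Fin n) := Finset.univ.map inr with hL
  have hwL : ∀ z : Cube (Fin n), weightOn L z = weight fun i => z (e (.inr i)) := by
    intro z
    rw [weight, weightOn, weightOn, hL, Finset.filter_map, Finset.card_map]
    rfl
  set proj : Cube (Fin n) → Cube κ := fun z i => z (e (.inl i)) with hproj
  have hhide : ∀ z, hide e k lo hi G z = if weightOn L z < lo then false
      else if weightOn L z ≤ hi then G (proj z) else decide (Odd k) := by
    intro z; rw [hwL]; rfl
  have hmain := card_relevant_steps_le L (fun z => (rel (proj z)).map inl)
    (fun z => by
      rw [Finset.disjoint_left]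
      intro i hi hi2
      simp only [hL, Finset.mem_map, Finset.mem_univ, true_and] at hi hi2
      obtain ⟨a, -, rfl⟩ := hi
      obtain ⟨b, hb⟩ := hi2
      exact Sum.inr_ne_inl (e.injective (show e (.inr b) = e (.inl a) from hb))) θ hθ0 hθ lo hi D
    (fun z _ hz => by
      have h1 : (((rel (proj z)).map inl).filter fun c => z c = false).card ≤ M :=
        (Finset.card_filter_le _ _).trans (by rw [Finset.card_map]; exact hM _)
      have h2 : weightOn L z + (L.filter fun c => z c = false).card = l := by
        have := Finset.card_filter_add_card_filter_not (s := L) (fun c => z c = true)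
        rw [hL, Finset.card_map, Finset.card_univ, Fintype.card_fin, ← hL] at this
        simpa [weightOn] using this
      have h3 : (l : ℝ) - hi ≤ (L.filter fun c => z c = false).card := by
        have h4 : (l : ℝ) = weightOn L z + (L.filter fun c => z c = false).card := by
          exact_mod_cast h2.symm
        have h5 : (weightOn L z : ℝ) ≤ hi := by exact_mod_cast hz
        linarith
      calc _ ≤ (M : ℝ) := by exact_mod_cast h1
        _ ≤ θ * (l - hi) := hhi
        _ ≤ _ := by gcongr)
  have hsub : (Finset.univ.filter fun σ : Equiv.Perm (Fin n) =>
      Detects k (hide e k lo hi G) fun t : Fin (n + 1) => initial σ t) ⊆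
      (Finset.univ.filter fun σ : Equiv.Perm (Fin n) =>
      D ≤ (Finset.univ.filter fun t : Fin n => (lo ≤ weightOn L (initial σ t) ∧
        weightOn L (initial σ t) ≤ hi) ∧
          σ t ∈ (rel (proj (initial σ t))).map inl).card) := by
    intro σ hσ
    simp only [Finset.mem_filter, Finset.mem_univ, true_and] at hσ ⊢
    obtain ⟨x, ⟨hx, hx0, halt⟩, hrange⟩ := hσ
    choose τ hτ using hrange
    have hval : ∀ j : Fin (k + 1), (hide e k lo hi G (x j) = true ↔ Even (j : ℕ)) := by
      intro j
      induction j using Fin.induction with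
      | zero => simpa using hx0
      | succ j ih =>
        have := halt j
        rw [Fin.val_succ, Nat.even_add_one, ← Fin.val_castSucc j, ← ih]
        revert this
        cases hide e k lo hi G (x j.castSucc) <;> cases hide e k lo hi G (x j.succ) <;> simp
    have hwmono : ∀ i j : Fin (k + 1), i ≤ j → weightOn L (x i) ≤ weightOn L (x j) :=
      fun i j hij => weightOn_mono L (hx.monotone hij)
    -- A violation starts with the value `1`, and below the window the function is `0`.
    have hlo : lo ≤ weightOn L (x 0) := by
      by_contra! h
      have := hhide (x 0)
      rw [if_pos h, hx0] at this
      exact absurd this (by simp)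
    -- The last point of a violation has value `1` exactly for even `k`, the opposite of the
    -- constant above the window.
    have hhi' : weightOn L (x (Fin.last k)) ≤ hi := by
      by_contra! h
      have h1 := hhide (x (Fin.last k))
      have h2 := hwmono 0 (Fin.last k) (Fin.zero_le _)
      rw [if_neg (by omega), if_neg (by omega)] at h1
      have h3 := hval (Fin.last k)
      rw [h1] at h3
      simp only [decide_eq_true_eq, Fin.val_last, ← Nat.not_even_iff_odd] at h3
      tauto
    have hGx : ∀ j, hide e k lo hi G (x j) = G (proj (x j)) := by
      intro j
      have h1 := hwmono 0 j (Fin.zero_le _)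
      have h2 := hwmono j (Fin.last k) (Fin.le_last _)
      rw [hhide, if_neg (by omega), if_pos (by omega)]
    have hτmono : ∀ i j : Fin (k + 1), i < j → τ i < τ j := by
      intro i j hij
      by_contra! h
      have h1 : initial σ (τ j) ≤ initial σ (τ i) := initial_mono σ h
      have h2 := hx hij
      rw [← hτ i, ← hτ j] at h2
      exact absurd h2 (not_lt_of_ge h1)
    -- `Fin.ofNat` reduces modulo `k + 1`; only the indices `j ≤ k`, where it does nothing, are
    -- used.
    set t : ℕ → ℕ := fun j => τ (Fin.ofNat (k + 1) j) with ht
    have hof : ∀ j, (hj : j ≤ k) → Fin.ofNat (k + 1) j = ⟨j, by omega⟩ := by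
      intro j hj
      ext
      simp [Nat.mod_eq_of_lt (show j < k + 1 by omega)]
    set S : Finset ℕ := (Finset.univ.filter fun s : Fin n =>
      σ s ∈ (rel (proj (initial σ s))).map inl).map Fin.valEmbedding with hS
    -- A step of the chain either sets a coordinate of `κ` or lies in `L` and leaves the projection
    -- unchanged.
    have hforce := hG (fun s => proj (initial σ s)) S (fun s => by
        rcases Nat.lt_or_ge s n with hs | hs
        · have hstep := initial_succ σ ⟨s, hs⟩
          simp only at hstep
          obtain ⟨d, hd⟩ := e.surjective (σ ⟨s, hs⟩)
          rcases d with c | c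
          · right
            refine ⟨c, ?_, ?_, fun hc => ?_⟩
            · have := initial_self σ ⟨s, hs⟩
              simp only [hproj, hd]
              exact this
            · funext i
              simp only [hproj, hstep, Function.update_apply, ← hd, EmbeddingLike.apply_eq_iff_eq,
                Sum.inl.injEq]
            · simp only [hS, Finset.mem_map, Finset.mem_filter, Finset.mem_univ, true_and,
                Fin.valEmbedding_apply]
              exact ⟨⟨s, hs⟩, ⟨c, hc, hd⟩, rfl⟩
          · left
            funext i
            simp only [hproj, hstep]
            rw [Function.update_of_ne]
            rw [← hd]
            simp
        · left
          rw [initial_of_le σ hs, initial_of_le σ (by omega)])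
      t (fun j hj => by
        have := hτmono ⟨j, by omega⟩ ⟨j + 1, by omega⟩ (by simp)
        simp only [ht]
        rw [hof j (by omega), hof (j + 1) (by omega)]
        exact this)
      (fun j hj => by
        have h1 := hval ⟨j, by omega⟩
        rw [hGx, ← hτ] at h1
        simp only [ht]
        rw [hof j hj]
        exact h1)
    refine hforce.trans ?_
    rw [← Finset.card_map (Fin.valEmbedding (n := n))]
    refine Finset.card_le_card fun s hs => ?_
    simp only [Finset.mem_filter, Finset.mem_Ico, hS, Finset.mem_map, Finset.mem_univ, true_and,
      Fin.valEmbedding_apply] at hs ⊢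
    obtain ⟨⟨hs1, hs2⟩, s', hs', rfl⟩ := hs
    refine ⟨s', ⟨⟨?_, ?_⟩, hs'⟩, rfl⟩
    · refine hlo.trans ?_
      rw [← hτ 0]
      refine weightOn_mono L (initial_mono σ ?_)
      have : t 0 = τ 0 := rfl
      omega
    · refine le_trans ?_ hhi'
      rw [← hτ (Fin.last k)]
      refine weightOn_mono L (initial_mono σ ?_)
      have : t k = τ (Fin.last k) := by
        simp only [ht]
        rw [hof k le_rfl]
        rfl
      omega
  have hpos : 0 ≤ 2 ^ D * (1 - θ) ^ (hi + 1 - lo) :=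
    mul_nonneg (by positivity) (pow_nonneg (by linarith) _)
  rw [detectionProb_eq, div_mul_eq_mul_div, div_le_one (by positivity)]
  refine le_trans ?_ hmain
  refine mul_le_mul_of_nonneg_right ?_ hpos
  exact_mod_cast Finset.card_le_card hsub

/-! ### The window of width `√l / 50` -/

/-- The least weight in the window. -/
noncomputable def winLo (l : ℕ) : ℕ := ⌈(l : ℝ) / 2 - √l / 100⌉₊

/-- The greatest weight in the window. -/
noncomputable def winHi (l : ℕ) : ℕ := ⌊(l : ℝ) / 2 + √l / 100⌋₊

theorem winLo_le_iff {l w : ℕ} : winLo l ≤ w ↔ (l : ℝ) / 2 - √l / 100 ≤ w := Nat.ceil_le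

theorem le_winHi_iff {l w : ℕ} : w ≤ winHi l ↔ (w : ℝ) ≤ l / 2 + √l / 100 :=
  Nat.le_floor_iff (by positivity)

theorem two_hundred_le_sqrt {l : ℕ} (hl : 40000 ≤ l) : 200 ≤ √(l : ℝ) := by
  rw [Real.le_sqrt (by norm_num) (by positivity)]
  norm_num
  exact_mod_cast hl

/-- The interval has length `√l / 50`, and rounding adds at most `1 ≤ √l / 200`. -/
theorem winHi_add_one_sub_le {l : ℕ} (hl : 40000 ≤ l) :
    ((winHi l + 1 - winLo l : ℕ) : ℝ) ≤ √l / 40 := by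
  have h200 := two_hundred_le_sqrt hl
  rcases le_total (winLo l) (winHi l + 1) with h | h
  · rw [Nat.cast_sub h]
    have h1 : (winHi l : ℝ) ≤ l / 2 + √l / 100 := le_winHi_iff.1 le_rfl
    have h2 : (l : ℝ) / 2 - √l / 100 ≤ winLo l := winLo_le_iff.1 le_rfl
    push_cast
    linarith
  · rw [Nat.sub_eq_zero_of_le h, Nat.cast_zero]
    positivity

theorem le_winHi_add_one_sub {l : ℕ} (hl : 40000 ≤ l) :
    √l / 100 ≤ ((winHi l + 1 - winLo l : ℕ) : ℝ) := by
  have h200 := two_hundred_le_sqrt hl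
  have h1 : (l : ℝ) / 2 + √l / 100 < winHi l + 1 := Nat.lt_floor_add_one _
  have h2 : (winLo l : ℝ) < (l : ℝ) / 2 - √l / 100 + 1 := by
    apply Nat.ceil_lt_add_one
    have : √(l : ℝ) ^ 2 = l := Real.sq_sqrt (by positivity)
    nlinarith
  have h3 : winLo l ≤ winHi l + 1 := by
    have : (winLo l : ℝ) ≤ winHi l + 1 := by linarith
    exact_mod_cast this
  rw [Nat.cast_sub h3]
  push_cast
  linarith

/-- At least `√l / 100` levels, each with at least `2 ^ l / (4√l)` points. -/
theorem card_window_ge {l : ℕ} (hl : 40000 ≤ l) :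
    1 / 400 * 2 ^ l ≤ ((Finset.univ.filter fun x : Cube (Fin l) =>
      winLo l ≤ weight x ∧ weight x ≤ winHi l).card : ℝ) := by
  have h200 := two_hundred_le_sqrt hl
  have hsq : √(l : ℝ) ^ 2 = l := Real.sq_sqrt (by positivity)
  have hcard : (Finset.univ.filter fun x : Cube (Fin l) =>
      winLo l ≤ weight x ∧ weight x ≤ winHi l).card =
      ∑ v ∈ Finset.Icc (winLo l) (winHi l), l.choose v := by
    rw [Finset.card_eq_sum_card_fiberwise (f := weight) (t := Finset.Icc (winLo l) (winHi l))]
    · refine Finset.sum_congr rfl fun v hv => ?_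
      rw [← card_level, level, Finset.filter_filter]
      congr 1
      ext x
      simp only [Finset.mem_Icc] at hv
      simp only [Finset.mem_filter, Finset.mem_univ, true_and]
      constructor
      · rintro ⟨-, h⟩; exact h
      · rintro rfl; exact ⟨hv, rfl⟩
    · intro x hx
      simpa using hx
  rw [hcard]
  push_cast
  have hv : ∀ v ∈ Finset.Icc (winLo l) (winHi l), (2 : ℝ) ^ l / (4 * √l) ≤ l.choose v := by
    intro v hv
    rw [Finset.mem_Icc, winLo_le_iff, le_winHi_iff] at hv
    rw [div_le_iff₀ (by positivity), mul_comm]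
    exact two_pow_le_choose l v (√l / 100) (by rw [abs_le]; constructor <;> linarith [hv.1, hv.2])
      (by nlinarith) (by omega)
  calc (1 : ℝ) / 400 * 2 ^ l = (√l / 100) * (2 ^ l / (4 * √l)) := by
        field_simp; norm_num
    _ ≤ ((winHi l + 1 - winLo l : ℕ) : ℝ) * (2 ^ l / (4 * √l)) := by
        gcongr; exact le_winHi_add_one_sub hl
    _ = ∑ v ∈ Finset.Icc (winLo l) (winHi l), (2 : ℝ) ^ l / (4 * √l) := by
        rw [Finset.sum_const, nsmul_eq_mul, Nat.card_Icc]
    _ ≤ _ := Finset.sum_le_sum hv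

theorem detectionProb_hide_window_le {κ : Type} [Fintype κ] [DecidableEq κ] {l n k D M : ℕ}
    (hl : 40000 ≤ l) (e : κ ⊕ Fin l ≃ Fin n) {G : Cube κ → Bool} (rel : Cube κ → Finset κ)
    (hM : ∀ y, (rel y).card ≤ M) (hMl : 6 * M ≤ l) (hG : ForcesSteps G rel k D) :
    detectionProb k (hide e k (winLo l) (winHi l) G) ≤
      Real.exp (3 * M / (20 * √l) - D * Real.log 2) := by
  have h200 := two_hundred_le_sqrt hl
  have hsq : √(l : ℝ) ^ 2 = l := Real.sq_sqrt (by positivity)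
  have hl0 : (0 : ℝ) < l := by exact_mod_cast (by omega : 0 < l)
  have hMl' : 6 * (M : ℝ) ≤ l := by exact_mod_cast hMl
  -- At least `l / 3` coordinates of `L` are unset throughout the window. The hypothesis `6 * M ≤ l`
  -- gives `θ ≤ 1/2`, where `1 - θ ≥ exp (-2θ)`.
  set θ : ℝ := 3 * M / l with hθd
  have hθ0 : 0 ≤ θ := by positivity
  have hθ : θ ≤ 1 / 2 := by rw [hθd, div_le_iff₀ hl0]; linarith
  have hhi : (winHi l : ℝ) ≤ l / 2 + √l / 100 := le_winHi_iff.1 le_rfl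
  have h := detectionProb_hide_le (lo := winLo l) (hi := winHi l) e rel hM hG θ hθ0 hθ (by
    have h1 : (l : ℝ) / 3 ≤ l - winHi l := by nlinarith
    calc (M : ℝ) = θ * (l / 3) := by rw [hθd]; field_simp
      _ ≤ _ := by gcongr)
  have hexp : Real.exp (-(2 * θ)) ≤ 1 - θ := by
    rw [Real.exp_neg, inv_le_comm₀ (Real.exp_pos _) (by linarith)]
    refine le_trans ?_ (Real.add_one_le_exp (2 * θ))
    rw [inv_le_iff_one_le_mul₀ (by linarith)]
    nlinarith
  have hpow : Real.exp (-(3 * M / (20 * √l))) ≤ (1 - θ) ^ (winHi l + 1 - winLo l) := by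
    calc Real.exp (-(3 * M / (20 * √l)))
        ≤ Real.exp (((winHi l + 1 - winLo l : ℕ) : ℝ) * (-(2 * θ))) := by
          rw [Real.exp_le_exp]
          have h1 := winHi_add_one_sub_le hl
          have h2 : ((winHi l + 1 - winLo l : ℕ) : ℝ) * (2 * θ) ≤ √l / 40 * (2 * θ) := by gcongr
          have h3 : √l / 40 * (2 * θ) = 3 * M / (20 * √l) := by
            rw [hθd, ← hsq]
            rw [Real.sqrt_sq (by positivity)]
            field_simp
            ring
          linarith
      _ = Real.exp (-(2 * θ)) ^ (winHi l + 1 - winLo l) := by rw [Real.exp_nat_mul]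
      _ ≤ _ := pow_le_pow_left₀ (Real.exp_pos _).le hexp _
  have hprob0 : 0 ≤ detectionProb k (hide e k (winLo l) (winHi l) G) := by
    unfold detectionProb; positivity
  have h2D : Real.exp (D * Real.log 2) = 2 ^ D := by
    rw [Real.exp_nat_mul, Real.exp_log (by norm_num)]
  have hfin : detectionProb k (hide e k (winLo l) (winHi l) G) *
      (2 ^ D * Real.exp (-(3 * M / (20 * √l)))) ≤ 1 :=
    le_trans (by gcongr) h
  rw [← h2D, ← Real.exp_add] at hfin
  rw [show 3 * M / (20 * √(l : ℝ)) - D * Real.log 2 =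
    -(D * Real.log 2 + -(3 * M / (20 * √(l : ℝ)))) by ring, Real.exp_neg, ← one_div,
    le_div_iff₀ (Real.exp_pos _)]
  exact hfin
/-! ### Balanced blocks -/

/-- Number of points of weight less than `w` in the `m`-dimensional cube. -/
def cumChoose (m w : ℕ) : ℕ := ∑ v ∈ Finset.range w, m.choose v

/-- The first level of the `i`-th of `ℓ` blocks. -/
noncomputable def cut (m ℓ i : ℕ) : ℕ := sInf {w | min i ℓ * 2 ^ m ≤ ℓ * cumChoose m w}

theorem cumChoose_full (m : ℕ) : cumChoose m (m + 1) = 2 ^ m := Nat.sum_range_choose m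

/-- Because of the truncation `min i ℓ`, the set contains `m + 1` for every `i`, so the infimum is
attained and is never the default value. -/
theorem cut_mem (m ℓ i : ℕ) : min i ℓ * 2 ^ m ≤ ℓ * cumChoose m (cut m ℓ i) := by
  have : (m + 1) ∈ {w | min i ℓ * 2 ^ m ≤ ℓ * cumChoose m w} := by
    change min i ℓ * 2 ^ m ≤ ℓ * cumChoose m (m + 1)
    rw [cumChoose_full]
    exact Nat.mul_le_mul_right _ (min_le_right _ _)
  exact Nat.sInf_mem ⟨_, this⟩

theorem cut_le {m ℓ i w : ℕ} (h : min i ℓ * 2 ^ m ≤ ℓ * cumChoose m w) : cut m ℓ i ≤ w :=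
  Nat.sInf_le h

theorem cut_mono (m ℓ : ℕ) : Monotone (cut m ℓ) := fun i j hij =>
  cut_le (le_trans (Nat.mul_le_mul_right _ (by omega)) (cut_mem m ℓ j))

theorem cut_zero (m ℓ : ℕ) : cut m ℓ 0 = 0 := Nat.le_zero.1 (cut_le (by simp))

theorem cut_le_add_one (m ℓ i : ℕ) : cut m ℓ i ≤ m + 1 := by
  apply cut_le
  rw [cumChoose_full]
  exact Nat.mul_le_mul_right _ (min_le_right _ _)

theorem cumChoose_mono (m : ℕ) : Monotone (cumChoose m) := fun _ _ h =>
  Finset.sum_le_sum_of_subset (Finset.range_mono h)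

theorem cut_self {m ℓ : ℕ} (hℓ : 1 ≤ ℓ) : cut m ℓ ℓ = m + 1 := by
  refine le_antisymm (cut_le_add_one _ _ _) ?_
  by_contra! h
  have h1 := cut_mem m ℓ ℓ
  rw [min_self] at h1
  have h2 := Nat.le_of_mul_le_mul_left h1 (by omega)
  have h3 : cumChoose m (cut m ℓ ℓ) ≤ cumChoose m m := cumChoose_mono m (by omega)
  have h4 : cumChoose m (m + 1) = cumChoose m m + 1 := by
    rw [cumChoose, Finset.sum_range_succ, Nat.choose_self]; rfl
  rw [cumChoose_full] at h4
  omega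

theorem le_cumChoose_cut {m ℓ i : ℕ} (hℓ : 1 ≤ ℓ) (hi : i ≤ ℓ) :
    (i : ℝ) * (2 ^ m / ℓ) ≤ cumChoose m (cut m ℓ i) := by
  have hpos : (0 : ℝ) < ℓ := by exact_mod_cast hℓ
  have h := cut_mem m ℓ i
  rw [min_eq_left hi] at h
  have h' : (i : ℝ) * 2 ^ m ≤ ℓ * cumChoose m (cut m ℓ i) := by exact_mod_cast h
  rw [mul_div_assoc', div_le_iff₀ hpos]
  linarith

/-- By minimality of the cut the target is overshot by less than one level, which has at most `2 ^ m
/ √m` points. -/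
theorem cumChoose_cut_le {m ℓ i : ℕ} (hm : 1 ≤ m) (hℓ : 1 ≤ ℓ) (hi : i ≤ ℓ) :
    (cumChoose m (cut m ℓ i) : ℝ) ≤ i * (2 ^ m / ℓ) + 2 ^ m / √m := by
  have hpos : (0 : ℝ) < ℓ := by exact_mod_cast hℓ
  have hsm : 0 < √(m : ℝ) := Real.sqrt_pos.2 (by exact_mod_cast hm)
  rcases Nat.eq_zero_or_pos (cut m ℓ i) with h0 | h0
  · rw [h0]
    simp only [cumChoose, Finset.range_zero, Finset.sum_empty, Nat.cast_zero]
    positivity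
  · have hlt : ℓ * cumChoose m (cut m ℓ i - 1) < i * 2 ^ m := by
      by_contra! h
      have := cut_le (m := m) (ℓ := ℓ) (i := i) (w := cut m ℓ i - 1) (by rwa [min_eq_left hi])
      omega
    have hlt' : (ℓ : ℝ) * cumChoose m (cut m ℓ i - 1) < i * 2 ^ m := by exact_mod_cast hlt
    have h1 : (cumChoose m (cut m ℓ i - 1) : ℝ) ≤ i * (2 ^ m / ℓ) := by
      rw [mul_div_assoc', le_div_iff₀ hpos]
      linarith
    have h2 : (m.choose (cut m ℓ i - 1) : ℝ) ≤ 2 ^ m / √m := by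
      rw [le_div_iff₀ hsm, mul_comm]
      exact sqrt_mul_choose_le _ _
    have h3 : cumChoose m (cut m ℓ i) =
        cumChoose m (cut m ℓ i - 1) + m.choose (cut m ℓ i - 1) := by
      obtain ⟨w, hw⟩ : ∃ w, cut m ℓ i = w + 1 := ⟨cut m ℓ i - 1, by omega⟩
      rw [hw, Nat.add_sub_cancel, cumChoose, Finset.sum_range_succ]
      rfl
    rw [h3]
    push_cast
    linarith

theorem sum_Ico_choose {m a b : ℕ} (hab : a ≤ b) :
    ∑ v ∈ Finset.Ico a b, (m.choose v : ℝ) = cumChoose m b - cumChoose m a := by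
  rw [Finset.sum_Ico_eq_sub _ hab]
  simp [cumChoose]

theorem block_le {m ℓ i : ℕ} (hm : 1 ≤ m) (hi : i < ℓ) :
    ∑ v ∈ Finset.Ico (cut m ℓ i) (cut m ℓ (i + 1)), (m.choose v : ℝ) ≤
      2 ^ m / ℓ + 2 ^ m / √m := by
  rw [sum_Ico_choose (cut_mono m ℓ (Nat.le_succ i))]
  have h1 := le_cumChoose_cut (m := m) (ℓ := ℓ) (i := i) (by omega) (by omega)
  have h2 := cumChoose_cut_le (m := m) (ℓ := ℓ) (i := i + 1) hm (by omega) (by omega)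
  push_cast at h2
  linarith

theorem le_block {m ℓ i : ℕ} (hm : 1 ≤ m) (hi : i < ℓ) :
    2 ^ m / ℓ - 2 ^ m / √m ≤
      ∑ v ∈ Finset.Ico (cut m ℓ i) (cut m ℓ (i + 1)), (m.choose v : ℝ) := by
  rw [sum_Ico_choose (cut_mono m ℓ (Nat.le_succ i))]
  have h1 := le_cumChoose_cut (m := m) (ℓ := ℓ) (i := i + 1) (by omega) (by omega)
  have h2 := cumChoose_cut_le (m := m) (ℓ := ℓ) (i := i) hm (by omega) (by omega)
  push_cast at h1
  linarith

/-- The index of the block that contains level `w`. -/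
noncomputable def blockIdx (m ℓ w : ℕ) : ℕ :=
  ((Finset.range ℓ).filter fun i => cut m ℓ (i + 1) ≤ w).card

theorem blockIdx_mono (m ℓ : ℕ) : Monotone (blockIdx m ℓ) := by
  intro v w hvw
  refine Finset.card_le_card fun i hi => ?_
  simp only [Finset.mem_filter] at hi ⊢
  exact ⟨hi.1, hi.2.trans hvw⟩

theorem blockIdx_eq {m ℓ i w : ℕ} (hi : i < ℓ) (h1 : cut m ℓ i ≤ w) (h2 : w < cut m ℓ (i + 1)) :
    blockIdx m ℓ w = i := by
  have : (Finset.range ℓ).filter (fun j => cut m ℓ (j + 1) ≤ w) = Finset.range i := by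
    ext j
    simp only [Finset.mem_filter, Finset.mem_range]
    constructor
    · rintro ⟨-, h⟩
      by_contra! hij
      have := cut_mono m ℓ (show i + 1 ≤ j + 1 by omega)
      omega
    · intro hj
      have := cut_mono m ℓ (show j + 1 ≤ i by omega)
      exact ⟨by omega, by omega⟩
  rw [blockIdx, this, Finset.card_range]

theorem blockIdx_spec {m ℓ w : ℕ} (hℓ : 1 ≤ ℓ) (hw : w ≤ m) :
    blockIdx m ℓ w < ℓ ∧ cut m ℓ (blockIdx m ℓ w) ≤ w ∧ w < cut m ℓ (blockIdx m ℓ w + 1) := by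
  have hex : ∃ i, w < cut m ℓ (i + 1) := ⟨ℓ - 1, by
    rw [Nat.sub_add_cancel hℓ, cut_self hℓ]; omega⟩
  classical
  set i := Nat.find hex with hi
  have h1 : w < cut m ℓ (i + 1) := Nat.find_spec hex
  have h2 : i ≤ ℓ - 1 := Nat.find_min' hex (by rw [Nat.sub_add_cancel hℓ, cut_self hℓ]; omega)
  have h3 : cut m ℓ i ≤ w := by
    rcases Nat.eq_zero_or_pos i with h | h
    · rw [h, cut_zero]; omega
    · have := Nat.find_min hex (m := i - 1) (by omega)
      rw [Nat.sub_add_cancel h] at this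
      omega
  rw [blockIdx_eq (by omega) h3 h1]
  exact ⟨by omega, h3, h1⟩

/-- The balanced blocks function with `ℓ` blocks. -/
noncomputable def blockFn (ι : Type) [Fintype ι] (ℓ : ℕ) : Cube ι → Bool :=
  fun y => decide (Even (blockIdx (Fintype.card ι) ℓ (weight y)))

theorem weight_le_card {ι : Type} [Fintype ι] (y : Cube ι) : weight y ≤ Fintype.card ι :=
  Finset.card_filter_le _ _

theorem weight_comp_equiv {ι κ : Type} [Fintype ι] [Fintype κ] (e : κ ≃ ι) (y : Cube ι) :
    weight (fun i => y (e i)) = weight y := by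
  unfold weight weightOn
  refine Finset.card_bij (fun i _ => e i) ?_ ?_ ?_
  · intro i hi; simpa using hi
  · intro i _ j _ h; exact e.injective h
  · intro i hi
    exact ⟨e.symm i, by simpa using hi, by simp⟩

theorem natCard_weight_Ico (ι : Type) [Fintype ι] (a b : ℕ) :
    (Nat.card {y : Cube ι // a ≤ weight y ∧ weight y < b} : ℝ) =
      ∑ v ∈ Finset.Ico a b, ((Fintype.card ι).choose v : ℝ) := by
  set m := Fintype.card ι with hm
  have e : ι ≃ Fin m := Fintype.equivFin ι
  have h1 : Nat.card {y : Cube ι // a ≤ weight y ∧ weight y < b} =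
      Nat.card {y : Cube (Fin m) // a ≤ weight y ∧ weight y < b} := by
    refine Nat.card_congr (Equiv.subtypeEquiv (Equiv.arrowCongr e (Equiv.refl Bool)) fun y => ?_)
    have : weight (Equiv.arrowCongr e (Equiv.refl Bool) y) = weight y :=
      weight_comp_equiv e.symm y
    rw [this]
  rw [h1, Nat.card_eq_fintype_card, Fintype.card_subtype,
    Finset.card_eq_sum_card_fiberwise (f := weight) (t := Finset.Ico a b)]
  · push_cast
    refine Finset.sum_congr rfl fun v hv => ?_
    rw [← card_level, level, Finset.filter_filter]
    congr 2
    ext x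
    simp only [Finset.mem_Ico] at hv
    simp only [Finset.mem_filter, Finset.mem_univ, true_and]
    constructor
    · rintro ⟨-, h⟩; exact h
    · rintro rfl; exact ⟨hv, rfl⟩
  · intro x hx
    simpa using hx

theorem isBalancedBlocks_blockFn {ι : Type} [Fintype ι] {ℓ : ℕ} (hℓ : 1 ≤ ℓ)
    (hι : 1 ≤ Fintype.card ι) : IsBalancedBlocks ℓ (blockFn ι ℓ) := by
  set m := Fintype.card ι with hm
  refine ⟨cut m ℓ, cut_mono m ℓ, cut_zero m ℓ, cut_self hℓ, fun i hi => ?_⟩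
  have hpos : (0 : ℝ) < ℓ := by exact_mod_cast hℓ
  have hsm : 0 < √(m : ℝ) := Real.sqrt_pos.2 (by exact_mod_cast hι)
  rw [natCard_weight_Ico, ← hm]
  refine ⟨?_, ?_, fun y h1 h2 => ?_⟩
  · refine le_trans (le_of_eq ?_) (le_block hι hi)
    field_simp
  · refine (block_le hι hi).trans (le_of_eq ?_)
    field_simp
  · rw [blockFn, ← hm, blockIdx_eq hi h1 h2]
    simp

/-! ### Paths through the blocks -/

theorem weight_update_le {ι : Type} [Fintype ι] [DecidableEq ι] (y : Cube ι) (c : ι) :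
    weight (Function.update y c true) ≤ weight y + 1 := by
  unfold weight weightOn
  refine le_trans (Finset.card_le_card (t := insert c (Finset.univ.filter fun i => y i = true)) ?_)
    (Finset.card_insert_le _ _)
  intro i hi
  simp only [Finset.mem_filter, Finset.mem_univ, true_and, Finset.mem_insert] at hi ⊢
  by_cases h : i = c
  · exact Or.inl h
  · rw [Function.update_of_ne h] at hi
    exact Or.inr hi

theorem le_update_true {ι : Type} [DecidableEq ι] (y : Cube ι) (c : ι) :
    y ≤ Function.update y c true := by
  intro i
  rcases eq_or_ne i c with h | h
  · rw [h, Function.update_self]; exact Bool.le_true _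
  · rw [Function.update_of_ne h]

/-- The block index is monotone along the path and changes parity at each alternation, so `k - 1`
blocks are crossed completely. A level has at most `2 ^ m / √m` points, so `hblock` gives each block
at least `W` levels, and each level costs a step. Leaving the first block costs one more step. -/
theorem forcesSteps_blockFn {m ℓ k D : ℕ} (hm : 1 ≤ m) (hℓ : 1 ≤ ℓ) {W : ℝ}
    (hblock : 2 ^ m * W / √m ≤ 2 ^ m / ℓ - 2 ^ m / √m) (hk : 1 ≤ k)
    (hD : (D : ℝ) < (k - 1) * W + 1) :
    ForcesSteps (blockFn (Fin m) ℓ) (fun _ => Finset.univ) k D := by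
  intro Y S hY t ht halt
  have hsm : 0 < √(m : ℝ) := Real.sqrt_pos.2 (by exact_mod_cast hm)
  have hwm : ∀ y : Cube (Fin m), weight y ≤ m := fun y => (weight_le_card y).trans_eq (by simp)
  have hYmono : Monotone Y := monotone_nat_of_le_succ fun s => by
    rcases hY s with h | ⟨c, -, h, -⟩
    · rw [h]
    · rw [h]; exact le_update_true _ _
  have hYw : Monotone fun s => weight (Y s) := fun s u h => weightOn_mono _ (hYmono h)
  have hcount : ∀ d, weight (Y (t 0 + d)) ≤
      weight (Y (t 0)) + ((Finset.Ico (t 0) (t 0 + d)).filter (· ∈ S)).card := by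
    intro d
    induction d with
    | zero => simp
    | succ d ih =>
      rw [← add_assoc, ← Finset.insert_Ico_right_eq_Ico_add_one (by omega), Finset.filter_insert]
      rcases hY (t 0 + d) with h | ⟨c, -, h, hS⟩
      · rw [h]
        refine ih.trans (Nat.add_le_add_left (Finset.card_le_card ?_) _)
        split_ifs
        · exact Finset.subset_insert _ _
        · exact subset_rfl
      · rw [if_pos (hS (Finset.mem_univ c)), Finset.card_insert_of_notMem (by simp), h]
        have := weight_update_le (Y (t 0 + d)) c
        omega
  have ht0 : ∀ j ≤ k, t 0 ≤ t j := by
    intro j hj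
    induction j with
    | zero => exact le_rfl
    | succ j ih =>
      have := ht j (by omega)
      have := ih (by omega)
      omega
  set idx : ℕ → ℕ := fun j => blockIdx m ℓ (weight (Y (t j))) with hidx
  have hpar : ∀ j ≤ k, (Even (idx j) ↔ Even j) := by
    intro j hj
    rw [← halt j hj]
    simp [blockFn, hidx]
  have hinc : ∀ j ≤ k, idx 0 + j ≤ idx j := by
    intro j hj
    induction j with
    | zero => simp
    | succ j ih =>
      have h1 := ih (by omega)
      have h2 : idx j ≤ idx (j + 1) := blockIdx_mono m ℓ (hYw (ht j (by omega)).le)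
      have h3 : idx j ≠ idx (j + 1) := by
        intro h
        have e1 := hpar j (by omega)
        have e2 := hpar (j + 1) hj
        rw [← h, e1, Nat.even_add_one] at e2
        tauto
      omega
  obtain ⟨-, -, h0⟩ := blockIdx_spec (ℓ := ℓ) hℓ (hwm (Y (t 0)))
  obtain ⟨hkℓ, hk1, -⟩ := blockIdx_spec (ℓ := ℓ) hℓ (hwm (Y (t k)))
  have hwidth : ∀ i < ℓ, W ≤ (cut m ℓ (i + 1) : ℝ) - cut m ℓ i := by
    intro i hi
    have h1 := hblock.trans (le_block hm hi)
    have h2 : ∑ v ∈ Finset.Ico (cut m ℓ i) (cut m ℓ (i + 1)), (m.choose v : ℝ) ≤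
        ∑ v ∈ Finset.Ico (cut m ℓ i) (cut m ℓ (i + 1)), (2 : ℝ) ^ m / √m := by
      refine Finset.sum_le_sum fun v _ => ?_
      rw [le_div_iff₀ hsm, mul_comm]
      exact sqrt_mul_choose_le _ _
    rw [Finset.sum_const, nsmul_eq_mul, Nat.card_Ico,
      Nat.cast_sub (cut_mono m ℓ (Nat.le_succ i))] at h2
    have h3 := h1.trans h2
    have h4 : (2 : ℝ) ^ m / √m * W ≤
        2 ^ m / √m * ((cut m ℓ (i + 1) : ℝ) - cut m ℓ i) := by
      calc (2 : ℝ) ^ m / √m * W = 2 ^ m * W / √m := by ring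
        _ ≤ _ := h3
        _ = _ := by ring
    exact le_of_mul_le_mul_left h4 (by positivity)
  have hcuts : ∀ d, idx 0 + 1 + d ≤ ℓ → (d : ℝ) * W ≤
      (cut m ℓ (idx 0 + 1 + d) : ℝ) - cut m ℓ (idx 0 + 1) := by
    intro d hd
    induction d with
    | zero => simp
    | succ d ih =>
      have h1 := ih (by omega)
      have h2 := hwidth (idx 0 + 1 + d) (by omega)
      rw [← add_assoc]
      push_cast
      linarith
  have hk2 := hinc k le_rfl
  have hd := hcuts (k - 1) (by
    have : idx k < ℓ := hkℓ
    omega)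
  rw [show idx 0 + 1 + (k - 1) = idx 0 + k by omega, Nat.cast_sub hk] at hd
  have hc2 : cut m ℓ (idx 0 + k) ≤ weight (Y (t k)) := (cut_mono m ℓ hk2).trans hk1
  have hfin := hcount (t k - t 0)
  rw [Nat.add_sub_cancel' (ht0 k le_rfl)] at hfin
  set N := ((Finset.Ico (t 0) (t k)).filter (· ∈ S)).card
  have hN : cut m ℓ (idx 0 + k) + 1 ≤ cut m ℓ (idx 0 + 1) + N := by
    have : weight (Y (t 0)) < cut m ℓ (idx 0 + 1) := h0
    omega
  have hN' : (cut m ℓ (idx 0 + k) : ℝ) + 1 ≤ cut m ℓ (idx 0 + 1) + N := by exact_mod_cast hN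
  have : (D : ℝ) < N + 1 := by push_cast at hd; linarith
  have : D < N + 1 := by exact_mod_cast this
  omega

/-! ### Monotone functions and blocks of levels -/

/-- The chains on which `G` differs from the parity of `a` at all levels in `I`. -/
def badChains {m : ℕ} (G : Cube (Fin m) → Bool) (a : Cube (Fin m) → ℕ) (I : Finset ℕ) :
    Finset (Equiv.Perm (Fin m)) :=
  Finset.univ.filter fun σ => ∀ s ∈ I, Mismatch G a (initial σ s)

theorem mem_badChains {m : ℕ} {G : Cube (Fin m) → Bool} {a : Cube (Fin m) → ℕ} {I : Finset ℕ}
    {σ : Equiv.Perm (Fin m)} :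
    σ ∈ badChains G a I ↔ ∀ s ∈ I, Mismatch G a (initial σ s) := by
  simp [badChains]

/-- A bad chain has a mismatch at every level of `I`, and its point on a level is uniform, so the
fraction of bad chains is at most the fraction of mismatches on each level. Weighting by level sizes
turns this into a count of points. -/
theorem card_badChains_le {m : ℕ} (G : Cube (Fin m) → Bool) (a : Cube (Fin m) → ℕ)
    (I : Finset ℕ) (hI : ∀ s ∈ I, s ≤ m) :
    (∑ s ∈ I, (m.choose s : ℝ)) * ((badChains G a I).card : ℝ) ≤
      m.factorial * ∑ s ∈ I, (((level m s).filter (Mismatch G a)).card : ℝ) := by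
  set P := Mismatch G a
  have h1 : ∀ s ∈ I, (m.factorial : ℝ) * (((level m s).filter P).card : ℝ) =
      m.choose s * ((Finset.univ.filter fun σ : Equiv.Perm (Fin m) => P (initial σ s)).card : ℝ) := by
    intro s hs
    have := sum_level_eq (fun z => if P z then (1 : ℝ) else 0) (hI s hs)
    simpa using this
  rw [Finset.mul_sum, Finset.sum_congr rfl h1, Finset.sum_mul]
  refine Finset.sum_le_sum fun s hs => ?_
  refine mul_le_mul_of_nonneg_left ?_ (by positivity)
  refine Nat.cast_le.2 (Finset.card_le_card fun σ hσ => ?_)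
  simp only [badChains, Finset.mem_filter, Finset.mem_univ, true_and] at hσ ⊢
  exact hσ s hs

/-- Across two consecutive blocks on which `G` has opposite values, a monotone function whose
parity is `G` somewhere in each of the blocks increases. -/
theorem sum_initial_increase {m : ℕ} {a : Cube (Fin m) → ℕ} (ha : Monotone a)
    (G : Cube (Fin m) → Bool) (u v w : ℕ) (b : Bool)
    (hG1 : ∀ z, u ≤ weight z → weight z < v → G z = b)
    (hG2 : ∀ z, v ≤ weight z → weight z < w → G z = !b) (huw : u < w) (hw : w ≤ m + 1) :
    (m.factorial : ℝ) - ((badChains G a (Finset.Ico u v)).card : ℝ) -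
      ((badChains G a (Finset.Ico v w)).card : ℝ) ≤
      ∑ σ : Equiv.Perm (Fin m), (a (initial σ (w - 1)) : ℝ) -
        ∑ σ : Equiv.Perm (Fin m), (a (initial σ u) : ℝ) := by
  set bad1 := badChains G a (Finset.Ico u v) with hb1
  set bad2 := badChains G a (Finset.Ico v w) with hb2
  -- On a chain bad in neither block the rank has different parities at two levels `s < s'`, hence
  -- rises by at least one.
  have hpt : ∀ σ : Equiv.Perm (Fin m), (1 : ℝ) - (if σ ∈ bad1 then 1 else 0) -
      (if σ ∈ bad2 then 1 else 0) ≤ (a (initial σ (w - 1)) : ℝ) - a (initial σ u) := by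
    intro σ
    have hle : (a (initial σ u) : ℝ) ≤ a (initial σ (w - 1)) := by
      exact_mod_cast ha (initial_mono σ (by omega))
    by_cases h1 : σ ∈ bad1
    · rw [if_pos h1]
      split_ifs <;> linarith
    by_cases h2 : σ ∈ bad2
    · rw [if_pos h2, if_neg h1]
      linarith
    rw [if_neg h1, if_neg h2]
    simp only [hb1, hb2, mem_badChains, Mismatch, not_forall, not_not, Finset.mem_Ico] at h1 h2
    obtain ⟨s, hs, hs2⟩ := h1
    obtain ⟨s', hs', hs2'⟩ := h2
    rw [hG1 _ (by rw [weight_initial σ s (by omega)]; omega)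
      (by rw [weight_initial σ s (by omega)]; omega)] at hs2
    rw [hG2 _ (by rw [weight_initial σ s' (by omega)]; omega)
      (by rw [weight_initial σ s' (by omega)]; omega)] at hs2'
    have e1 : a (initial σ u) ≤ a (initial σ s) := ha (initial_mono σ (by omega))
    have e2 : a (initial σ s) ≤ a (initial σ s') := ha (initial_mono σ (by omega))
    have e3 : a (initial σ s') ≤ a (initial σ (w - 1)) := ha (initial_mono σ (by omega))
    have e4 : a (initial σ s) ≠ a (initial σ s') := by
      intro h
      rw [← h, ← hs2] at hs2'
      cases b <;> simp at hs2'
    have : a (initial σ u) + 1 ≤ a (initial σ (w - 1)) := by omega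
    have : (a (initial σ u) : ℝ) + 1 ≤ a (initial σ (w - 1)) := by exact_mod_cast this
    linarith
  have h := Finset.sum_le_sum fun σ (_ : σ ∈ Finset.univ) => hpt σ
  rw [Finset.sum_sub_distrib, Finset.sum_sub_distrib, Finset.sum_sub_distrib, Finset.sum_boole,
    Finset.sum_boole, Finset.sum_const, Finset.card_univ, Fintype.card_perm, Fintype.card_fin,
    nsmul_eq_mul, mul_one] at h
  simpa using h

theorem sum_card_level_filter_le {m : ℕ} (P : Cube (Fin m) → Prop) [DecidablePred P]
    (I : Finset ℕ) :
    ∑ s ∈ I, ((level m s).filter P).card ≤ (Finset.univ.filter P).card := by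
  rw [← Finset.card_biUnion]
  · refine Finset.card_le_card fun z hz => ?_
    simp only [Finset.mem_biUnion, Finset.mem_filter] at hz
    simp only [Finset.mem_filter, Finset.mem_univ, true_and]
    exact hz.choose_spec.2.2
  · intro s _ s' _ hss
    rw [Function.onFun, Finset.disjoint_left]
    intro z hz hz'
    simp only [Finset.mem_filter, mem_level] at hz hz'
    omega

/-- Over each pair of consecutive blocks the average rank rises by one, up to bad chains. There are
`⌊3g/2⌋` pairs but the total rise is at most `g`, so the fractions of bad chains add up to at least
`g / 4`. A block has at least `2 ^ m / (6g)` points, whence `1/24`. -/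
theorem farFromRanks_blockFn {m g : ℕ} (hg : 2 ≤ g) (hm : 6 * (g : ℝ) ≤ √m) :
    FarFromRanks (1 / 24) g (blockFn (Fin m) (3 * g)) := by
  intro a ha hag
  have hg' : (2 : ℝ) ≤ g := by exact_mod_cast hg
  have hsm : 0 < √(m : ℝ) := by linarith
  have hm1 : 1 ≤ m := by
    by_contra! h
    have : m = 0 := by omega
    subst this
    simp at hsm
  set ℓ := 3 * g with hℓ
  set G := blockFn (Fin m) ℓ with hG
  set c := cut m ℓ with hc
  have hcm : Monotone c := cut_mono m ℓ
  set bad : ℕ → ℝ := fun i => ((badChains G a (Finset.Ico (c i) (c (i + 1)))).card : ℝ) with hbad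
  set mis : ℕ → ℝ := fun i =>
    ∑ s ∈ Finset.Ico (c i) (c (i + 1)), (((level m s).filter (Mismatch G a)).card : ℝ) with hmis
  -- Half of the average block size: `6g ≤ √m` makes the rounding error at most the other half.
  have hsize : ∀ i < ℓ, (2 : ℝ) ^ m / (6 * g) ≤
      ∑ v ∈ Finset.Ico (c i) (c (i + 1)), (m.choose v : ℝ) := by
    intro i hi
    refine le_trans ?_ (le_block hm1 hi)
    have h1 : (2 : ℝ) ^ m / √m ≤ 2 ^ m / (6 * g) := by gcongr
    have h2 : (2 : ℝ) ^ m / (ℓ : ℕ) = 2 * (2 ^ m / (6 * g)) := by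
      rw [hℓ]; push_cast; field_simp; norm_num
    rw [h2]
    linarith
  have hlt : ∀ i < ℓ, c i < c (i + 1) := by
    intro i hi
    by_contra! h
    have := hsize i hi
    rw [Finset.Ico_eq_empty_of_le h, Finset.sum_empty] at this
    have : (0 : ℝ) < 2 ^ m / (6 * g) := by positivity
    linarith
  have hbadle : ∀ i < ℓ, bad i * (2 ^ m / (6 * g)) ≤ m.factorial * mis i := by
    intro i hi
    refine le_trans ?_ (card_badChains_le G a (Finset.Ico (c i) (c (i + 1))) fun s hs => ?_)
    · rw [mul_comm]
      exact mul_le_mul_of_nonneg_right (hsize i hi) (Nat.cast_nonneg _)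
    · have : c (i + 1) ≤ m + 1 := cut_le_add_one m ℓ (i + 1)
      simp only [Finset.mem_Ico] at hs
      omega
  have hGval : ∀ i < ℓ, ∀ z : Cube (Fin m), c i ≤ weight z → weight z < c (i + 1) →
      G z = decide (Even i) := by
    intro i hi z h1 h2
    rw [hG, blockFn, Fintype.card_fin, blockIdx_eq hi h1 h2]
  set A : ℕ → ℝ := fun w => ∑ σ : Equiv.Perm (Fin m), (a (initial σ w) : ℝ) with hA
  have hAmono : Monotone A := fun u v huv => Finset.sum_le_sum fun σ _ => by
    exact_mod_cast ha (initial_mono σ huv)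
  have hstep : ∀ p, 2 * p + 1 < ℓ →
      (m.factorial : ℝ) - bad (2 * p) - bad (2 * p + 1) ≤ A (c (2 * p + 2)) - A (c (2 * p)) := by
    intro p hp
    have h1 := hlt (2 * p) (by omega)
    have h2 := hlt (2 * p + 1) (by omega)
    have := sum_initial_increase ha G (c (2 * p)) (c (2 * p + 1)) (c (2 * p + 1 + 1)) true
      (fun z hz1 hz2 => by rw [hGval (2 * p) (by omega) z hz1 hz2]; simp)
      (fun z hz1 hz2 => by rw [hGval (2 * p + 1) (by omega) z hz1 hz2]; simp)
      (by omega) (cut_le_add_one _ _ _)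
    -- This passes to the first level of the next pair. After the last block that level may be `m +
    -- 1`, where `initial` is still the top point.
    have h3 : A (c (2 * p + 2) - 1) ≤ A (c (2 * p + 2)) := hAmono (Nat.sub_le _ _)
    simp only [hA, hbad] at h3 ⊢
    linarith
  have htel : ∀ p, 2 * p ≤ ℓ → (p : ℝ) * m.factorial - ∑ i ∈ Finset.range (2 * p), bad i ≤
      A (c (2 * p)) - A (c 0) := by
    intro p hp
    induction p with
    | zero => simp
    | succ p ih =>
      have h1 := ih (by omega)
      have h2 := hstep p (by omega)
      rw [show 2 * (p + 1) = 2 * p + 1 + 1 by ring, Finset.sum_range_succ, Finset.sum_range_succ]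
      push_cast
      simp only [show 2 * p + 1 + 1 = 2 * p + 2 by ring] at *
      linarith
  set p := ℓ / 2 with hp
  have h1 := htel p (by omega)
  have hf : (0 : ℝ) < m.factorial := by positivity
  have hAle : A (c (2 * p)) - A (c 0) ≤ g * m.factorial := by
    have e0 : 0 ≤ A (c 0) := Finset.sum_nonneg fun σ _ => by positivity
    have e1 : A (c (2 * p)) ≤ ∑ σ : Equiv.Perm (Fin m), (g : ℝ) :=
      Finset.sum_le_sum fun σ _ => by exact_mod_cast hag _
    rw [Finset.sum_const, Finset.card_univ, Fintype.card_perm, Fintype.card_fin, nsmul_eq_mul] at e1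
    linarith
  have hmisle : ∑ i ∈ Finset.range (2 * p), mis i ≤ ((Finset.univ.filter (Mismatch G a)).card : ℝ) := by
    have e : ∀ q, ∑ i ∈ Finset.range q, mis i =
        ∑ s ∈ Finset.Ico (c 0) (c q), (((level m s).filter (Mismatch G a)).card : ℝ) := by
      intro q
      induction q with
      | zero => simp
      | succ q ih =>
        rw [Finset.sum_range_succ, ih]
        exact Finset.sum_Ico_consecutive _ (hcm (Nat.zero_le q)) (hcm (Nat.le_succ q))
    rw [e]
    exact_mod_cast sum_card_level_filter_le (Mismatch G a) _
  have hbadsum : (∑ i ∈ Finset.range (2 * p), bad i) * (2 ^ m / (6 * g)) ≤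
      m.factorial * ((Finset.univ.filter (Mismatch G a)).card : ℝ) := by
    refine le_trans ?_ (mul_le_mul_of_nonneg_left hmisle hf.le)
    rw [Finset.sum_mul, Finset.mul_sum]
    refine Finset.sum_le_sum fun i hi => hbadle i ?_
    have := Finset.mem_range.1 hi
    omega
  -- The inequality `5g ≤ 4⌊3g/2⌋` needs `g ≥ 2`.
  have hpg : (g : ℝ) / 4 ≤ p - g := by
    have : 5 * g ≤ 4 * p := by omega
    have : 5 * (g : ℝ) ≤ 4 * p := by exact_mod_cast this
    linarith
  have h2 : (g : ℝ) / 4 * m.factorial ≤ ∑ i ∈ Finset.range (2 * p), bad i := by nlinarith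
  have h3 : (g : ℝ) / 4 * m.factorial * (2 ^ m / (6 * g)) ≤
      m.factorial * ((Finset.univ.filter (Mismatch G a)).card : ℝ) :=
    le_trans (mul_le_mul_of_nonneg_right h2 (by positivity)) hbadsum
  have h4 : (m.factorial : ℝ) * (1 / 24 * 2 ^ m) ≤
      m.factorial * ((Finset.univ.filter (Mismatch G a)).card : ℝ) := by
    refine le_trans (le_of_eq ?_) h3
    field_simp
    norm_num
  rw [Fintype.card_fin]
  exact le_of_mul_le_mul_left h4 hf
/-! ### Orthogonality -/

/-- Summing over the coordinate `y c` first leaves the factor `∑ x, F x = 0`. -/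
theorem sum_mul_eq_zero {I X : Type} [Fintype I] [DecidableEq I] [Fintype X] {F : X → ℝ}
    (hF : ∑ x, F x = 0) {c d : I} (hcd : d ≠ c) : ∑ y : I → X, F (y c) * F (y d) = 0 := by
  classical
  rw [← Equiv.sum_comp (Equiv.funSplitAt c X).symm, Fintype.sum_prod_type, Finset.sum_comm]
  refine Finset.sum_eq_zero fun r _ => ?_
  have : ∀ x, F ((Equiv.funSplitAt c X).symm (x, r) c) * F ((Equiv.funSplitAt c X).symm (x, r) d) =
      F x * F (r ⟨d, hcd⟩) := by
    intro x
    simp [Equiv.funSplitAt, Equiv.piSplitAt, hcd]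
  simp only [this, ← Finset.sum_mul, hF, zero_mul]

theorem sum_sq_sum_le {I X : Type} [Fintype I] [DecidableEq I] [Fintype X] {F : X → ℝ}
    (hF : ∑ x, F x = 0) (hF2 : ∀ x, F x ^ 2 ≤ 1) (T : Finset I) :
    ∑ y : I → X, (∑ c ∈ T, F (y c)) ^ 2 ≤ T.card * (Fintype.card (I → X) : ℝ) := by
  induction T using Finset.induction_on with
  | empty => simp
  | insert a T ha ih =>
    have hcross : ∑ y : I → X, F (y a) * ∑ c ∈ T, F (y c) = 0 := by
      simp only [Finset.mul_sum]
      rw [Finset.sum_comm]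
      refine Finset.sum_eq_zero fun c hc => sum_mul_eq_zero hF ?_
      rintro rfl
      exact ha hc
    have hsq : ∑ y : I → X, F (y a) ^ 2 ≤ (Fintype.card (I → X) : ℝ) := by
      calc ∑ y : I → X, F (y a) ^ 2 ≤ ∑ y : I → X, (1 : ℝ) := Finset.sum_le_sum fun y _ => hF2 _
        _ = _ := by simp
    have e : ∀ y : I → X, (∑ c ∈ insert a T, F (y c)) ^ 2 =
        F (y a) ^ 2 + 2 * (F (y a) * ∑ c ∈ T, F (y c)) + (∑ c ∈ T, F (y c)) ^ 2 := by
      intro y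
      rw [Finset.sum_insert ha]
      ring
    simp only [e, Finset.sum_add_distrib, ← Finset.mul_sum, hcross]
    rw [Finset.card_insert_of_notMem ha]
    push_cast
    linarith

/-- Cauchy–Schwarz with `sum_sq_sum_le`. It serves twice: for the signs of the `m` bits of an
address, and for `halfSign` of the `m` blocks. -/
theorem sum_abs_sum_le {I X : Type} [Fintype I] [DecidableEq I] [Fintype X] {F : X → ℝ}
    (hF : ∑ x, F x = 0) (hF2 : ∀ x, F x ^ 2 ≤ 1) (T : Finset I) :
    ∑ y : I → X, |∑ c ∈ T, F (y c)| ≤ √(Fintype.card I) * (Fintype.card (I → X) : ℝ) := by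
  have h1 := sq_sum_le_card_mul_sum_sq (s := (Finset.univ : Finset (I → X)))
    (f := fun y => |∑ c ∈ T, F (y c)|)
  simp only [sq_abs, Finset.card_univ] at h1
  have h2 := sum_sq_sum_le hF hF2 T
  have h3 : (T.card : ℝ) ≤ Fintype.card I := by exact_mod_cast Finset.card_le_univ T
  set N : ℝ := (Fintype.card (I → X) : ℝ)
  have hN : 0 ≤ N := Nat.cast_nonneg _
  apply (pow_le_pow_iff_left₀ (Finset.sum_nonneg fun y _ => abs_nonneg _) (by positivity)
    two_ne_zero).1
  rw [mul_pow, Real.sq_sqrt (Nat.cast_nonneg _)]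
  calc _ ≤ N * ∑ y : I → X, (∑ c ∈ T, F (y c)) ^ 2 := h1
    _ ≤ N * (T.card * N) := by gcongr
    _ ≤ N * (Fintype.card I * N) := by gcongr
    _ = _ := by ring

/-- Both sides sum over the edges of the cube, indexed on the left by the lower and on the right by
the upper endpoint. -/
theorem sum_filter_update {m : ℕ} (Φ : Cube (Fin m) → Fin m → ℝ) :
    ∑ y : Cube (Fin m), ∑ c ∈ Finset.univ.filter (fun c => y c = false),
      Φ (Function.update y c true) c =
    ∑ y : Cube (Fin m), ∑ c ∈ Finset.univ.filter (fun c => y c = true), Φ y c := by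
  simp only [Finset.sum_filter]
  rw [Finset.sum_comm, Finset.sum_comm (s := Finset.univ (α := Cube (Fin m)))]
  refine Finset.sum_congr rfl fun c _ => ?_
  rw [← Finset.sum_filter, ← Finset.sum_filter]
  refine Finset.sum_bij' (fun y _ => Function.update y c true)
    (fun y _ => Function.update y c false) ?_ ?_ ?_ ?_ ?_
  · intro y _; simp
  · intro y _; simp
  · intro y hy
    simp only [Finset.mem_filter, Finset.mem_univ, true_and] at hy
    rw [Function.update_idem, ← hy, Function.update_eq_self]
  · intro y hy
    simp only [Finset.mem_filter, Finset.mem_univ, true_and] at hy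
    rw [Function.update_idem, ← hy, Function.update_eq_self]
  · intro y _; rfl

/-! ### The parity of the weight -/

/-- The sign of the weight relative to `p + 1/2`. -/
noncomputable def halfSign (p : ℕ) {m : ℕ} (z : Cube (Fin m)) : ℝ :=
  if p + 1 ≤ weight z then 1 else -1

theorem weight_le {m : ℕ} (z : Cube (Fin m)) : weight z ≤ m := (weight_le_card z).trans_eq (by simp)

theorem sum_mul_halfSign (p : ℕ) {m : ℕ} (a : Cube (Fin m) → ℝ) :
    ∑ z, a z * halfSign p z = ∑ v ∈ Finset.range (m + 1),
      (if p + 1 ≤ v then (1 : ℝ) else -1) * ∑ z ∈ level m v, a z := by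
  rw [← Finset.sum_fiberwise_of_maps_to (s := Finset.univ) (t := Finset.range (m + 1))
    (g := fun z : Cube (Fin m) => weight z) (fun z _ => by
      rw [Finset.mem_range]; have := weight_le z; omega)]
  refine Finset.sum_congr rfl fun v _ => ?_
  rw [Finset.mul_sum, level]
  refine Finset.sum_congr rfl fun z hz => ?_
  simp only [Finset.mem_filter] at hz
  rw [halfSign, hz.2, mul_comm]

theorem sum_sign_choose {m p : ℕ} (hm : m = 2 * p + 1) :
    ∑ v ∈ Finset.range (m + 1), (if p + 1 ≤ v then (1 : ℝ) else -1) * m.choose v = 0 := by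
  have h1 := Nat.sum_range_choose_halfway p
  have h2 := Nat.sum_range_choose m
  subst hm
  rw [← Finset.sum_range_add_sum_Ico _ (show p + 1 ≤ 2 * p + 1 + 1 by omega)] at h2 ⊢
  rw [h1, show (2 : ℕ) ^ (2 * p + 1) = 4 ^ p + 4 ^ p by rw [pow_succ, pow_mul]; norm_num; ring] at h2
  have h3 := Nat.add_left_cancel h2
  rw [Finset.sum_congr rfl (g := fun v => -((2 * p + 1).choose v : ℝ)), Finset.sum_neg_distrib,
    Finset.sum_congr rfl (s₁ := Finset.Ico _ _) (g := fun v => ((2 * p + 1).choose v : ℝ)),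
    ← Nat.cast_sum, ← Nat.cast_sum, h1, h3]
  · simp
  · intro v hv
    rw [if_pos (Finset.mem_Ico.1 hv).1, one_mul]
  · intro v hv
    rw [if_neg (by have := Finset.mem_range.1 hv; omega)]
    ring

theorem sum_halfSign {m p : ℕ} (hm : m = 2 * p + 1) : ∑ z : Cube (Fin m), halfSign p z = 0 := by
  have := sum_mul_halfSign p (m := m) fun _ => 1
  simp only [one_mul, Finset.sum_const, card_level, nsmul_eq_mul, mul_one] at this
  rw [this, sum_sign_choose hm]

theorem halfSign_sq (p : ℕ) {m : ℕ} (z : Cube (Fin m)) : halfSign p z ^ 2 ≤ 1 := by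
  unfold halfSign; split_ifs <;> norm_num

theorem halfSign_le_one (p : ℕ) {m : ℕ} (z : Cube (Fin m)) : halfSign p z ≤ 1 := by
  unfold halfSign; split_ifs <;> norm_num

/-- The parity of the weight. -/
def evenWeight {m : ℕ} (z : Cube (Fin m)) : Bool := decide (Even (weight z))

/-- Each half of the cube loses `q` middle levels of at most `2 ^ m / √m` points, at most a quarter
of the cube since `4q ≤ √m`. -/
theorem tails_ge {m p q : ℕ} (hm : m = 2 * p + 1) (hq : q ≤ p) (hq2 : 4 * (q : ℝ) ≤ √m) :
    (2 : ℝ) ^ m / 4 ≤ ∑ v ∈ Finset.range (p - q + 1), (m.choose v : ℝ) ∧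
    (2 : ℝ) ^ m / 4 ≤ ∑ v ∈ Finset.Ico (p + 1 + q) (m + 1), (m.choose v : ℝ) := by
  have hsm : 0 < √(m : ℝ) := Real.sqrt_pos.2 (by rw [hm]; positivity)
  have hmid : ∀ I : Finset ℕ, I.card = q → ∑ v ∈ I, (m.choose v : ℝ) ≤ 2 ^ m / 4 := by
    intro I hI
    calc ∑ v ∈ I, (m.choose v : ℝ) ≤ ∑ v ∈ I, (2 : ℝ) ^ m / √m := by
          refine Finset.sum_le_sum fun v _ => ?_
          rw [le_div_iff₀ hsm, mul_comm]
          exact sqrt_mul_choose_le _ _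
      _ = q * (2 ^ m / √m) := by rw [Finset.sum_const, hI, nsmul_eq_mul]
      _ = 2 ^ m * (4 * q) / (4 * √m) := by field_simp
      _ ≤ 2 ^ m * √m / (4 * √m) := by gcongr
      _ = 2 ^ m / 4 := by field_simp
  have hlow : ∑ v ∈ Finset.range (p + 1), (m.choose v : ℝ) = 2 ^ m / 2 := by
    have h1 := Nat.sum_range_choose_halfway p
    rw [← hm] at h1
    rw [← Nat.cast_sum, h1, hm, pow_succ, pow_mul]
    norm_num
  have htot : ∑ v ∈ Finset.range (m + 1), (m.choose v : ℝ) = 2 ^ m := by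
    rw [← Nat.cast_sum, Nat.sum_range_choose]; norm_num
  constructor
  · have h1 := hmid (Finset.Ico (p - q + 1) (p + 1)) (by rw [Nat.card_Ico]; omega)
    rw [← Finset.sum_range_add_sum_Ico _ (show p - q + 1 ≤ p + 1 by omega)] at hlow
    linarith
  · have h1 := hmid (Finset.Ico (p + 1) (p + 1 + q)) (by rw [Nat.card_Ico]; omega)
    rw [← Finset.sum_range_add_sum_Ico _ (show p + 1 ≤ m + 1 by omega), hlow,
      ← Finset.sum_Ico_consecutive _ (show p + 1 ≤ p + 1 + q by omega)
      (show p + 1 + q ≤ m + 1 by omega)] at htot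
    linarith

/-- A monotone function whose parity is mostly that of the weight is correlated with
`halfSign`. -/
theorem le_sum_mul_halfSign {m p : ℕ} (hm : m = 2 * p + 1) (hm25 : 25 ≤ m)
    {a : Cube (Fin m) → ℕ} (ha : Monotone a) :
    2 ^ m * √m / 16 - 2 * √m * ((Finset.univ.filter (Mismatch evenWeight a)).card : ℝ) ≤
      ∑ z, (a z : ℝ) * halfSign p z := by
  have hmR : (m : ℝ) = 2 * p + 1 := by rw [hm]; push_cast; ring
  have hs5 : 5 ≤ √(m : ℝ) := by
    rw [Real.le_sqrt (by norm_num) (by positivity)]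
    norm_num
    exact_mod_cast hm25
  have hsq : √(m : ℝ) ^ 2 = m := Real.sq_sqrt (by positivity)
  set q := ⌊√(m : ℝ) / 4⌋₊ with hq
  have hq1 : (q : ℝ) ≤ √m / 4 := Nat.floor_le (by positivity)
  have hq2 : √(m : ℝ) / 4 < q + 1 := Nat.lt_floor_add_one _
  have hqp : q ≤ p := by
    have : (q : ℝ) ≤ p := by nlinarith
    exact_mod_cast this
  have hf : (0 : ℝ) < m.factorial := by positivity
  -- `A v` is the mean of `a` on level `v`. Single levels serve as blocks: the parity changes at
  -- every level, so `A` should rise by one each time.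
  set A : ℕ → ℝ := fun w => (∑ σ : Equiv.Perm (Fin m), (a (initial σ w) : ℝ)) / m.factorial with hA
  have hAmono : Monotone A := fun u v huv => by
    refine div_le_div_of_nonneg_right (Finset.sum_le_sum fun σ _ => ?_) hf.le
    exact_mod_cast ha (initial_mono σ huv)
  have hlevel : ∀ v ≤ m, ∑ z ∈ level m v, (a z : ℝ) = m.choose v * A v := by
    intro v hv
    have := sum_level_eq (fun z => (a z : ℝ)) hv
    rw [hA]
    field_simp
    linarith
  set bad : ℕ → ℝ := fun v => ((badChains evenWeight a (Finset.Ico v (v + 1))).card : ℝ) /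
    m.factorial with hbad
  set mis : ℕ → ℝ := fun v => (((level m v).filter (Mismatch evenWeight a)).card : ℝ) with hmis
  have hstep : ∀ v < m, 1 - bad v - bad (v + 1) ≤ A (v + 1) - A v := by
    intro v hv
    have h := sum_initial_increase ha evenWeight v (v + 1) (v + 1 + 1) (decide (Even v))
      (fun z h1 h2 => by
        have : weight z = v := by omega
        rw [evenWeight, this])
      (fun z h1 h2 => by
        have : weight z = v + 1 := by omega
        rw [evenWeight, this, ← decide_not, decide_eq_decide, Nat.even_add_one])
      (by omega) (by omega)
    rw [Nat.add_sub_cancel] at h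
    simp only [hA, hbad]
    rw [← sub_div, le_div_iff₀ hf, sub_mul, sub_mul, one_mul, div_mul_cancel₀ _ hf.ne',
      div_mul_cancel₀ _ hf.ne']
    exact h
  -- Levels this close to the middle have at least `2 ^ m / (4√m)` points, so many bad chains there
  -- mean many mismatches.
  have hbadle : ∀ v ∈ Finset.Ico (p - q) (p + 1 + q + 1), bad v ≤ 4 * √m / 2 ^ m * mis v := by
    intro v hv
    rw [Finset.mem_Ico] at hv
    have h1 := card_badChains_le evenWeight a (Finset.Ico v (v + 1)) (fun s hs => by
      rw [Finset.mem_Ico] at hs; omega)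
    rw [Nat.Ico_succ_singleton, Finset.sum_singleton, Finset.sum_singleton] at h1
    have h2 : (2 : ℝ) ^ m ≤ 4 * √m * m.choose v := by
      refine two_pow_le_choose m v (q + 1 / 2) ?_ (by nlinarith) (by omega)
      have e1 : (p : ℝ) - q ≤ v := by
        have : p ≤ v + q := by omega
        have : (p : ℝ) ≤ v + q := by exact_mod_cast this
        linarith
      have e2 : (v : ℝ) ≤ p + 1 + q := by exact_mod_cast (by omega : v ≤ p + 1 + q)
      rw [abs_le]
      constructor <;> linarith
    have h3 : (m.choose v : ℝ) * bad v ≤ mis v := by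
      simp only [hbad, hmis, Nat.Ico_succ_singleton]
      rw [mul_div_assoc', div_le_iff₀ hf]
      linarith
    have hb0 : 0 ≤ bad v := by positivity
    rw [div_mul_eq_mul_div, le_div_iff₀ (by positivity)]
    calc bad v * 2 ^ m ≤ bad v * (4 * √m * m.choose v) := by gcongr
      _ = 4 * √m * (m.choose v * bad v) := by ring
      _ ≤ _ := by gcongr
  have htel : ∀ d, p - q + d ≤ m → (d : ℝ) - ∑ v ∈ Finset.Ico (p - q) (p - q + d), bad v -
      ∑ v ∈ Finset.Ico (p - q) (p - q + d), bad (v + 1) ≤ A (p - q + d) - A (p - q) := by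
    intro d hd
    induction d with
    | zero => simp
    | succ d ih =>
      have h1 := ih (by omega)
      have h2 := hstep (p - q + d) (by omega)
      rw [← add_assoc, Finset.sum_Ico_succ_top (by omega), Finset.sum_Ico_succ_top (by omega)]
      push_cast
      linarith
  have hinc := htel (2 * q + 1) (by omega)
  rw [show p - q + (2 * q + 1) = p + 1 + q by omega] at hinc
  set B := ∑ v ∈ Finset.Ico (p - q) (p + 1 + q + 1), bad v with hB
  have hb0 : ∀ v, 0 ≤ bad v := fun v => by positivity
  have hB1 : ∑ v ∈ Finset.Ico (p - q) (p + 1 + q), bad v ≤ B :=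
    Finset.sum_le_sum_of_subset_of_nonneg (Finset.Ico_subset_Ico_right (by omega))
      fun v _ _ => hb0 v
  have hB2 : ∑ v ∈ Finset.Ico (p - q) (p + 1 + q), bad (v + 1) ≤ B := by
    rw [Finset.sum_Ico_add' (fun v => bad v) (p - q) (p + 1 + q) 1]
    exact Finset.sum_le_sum_of_subset_of_nonneg (Finset.Ico_subset_Ico_left (by omega))
      fun v _ _ => hb0 v
  set M : ℝ := ((Finset.univ.filter (Mismatch evenWeight a)).card : ℝ) with hM
  have hBM : B ≤ 4 * √m / 2 ^ m * M := by
    refine (Finset.sum_le_sum hbadle).trans ?_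
    rw [← Finset.mul_sum]
    refine mul_le_mul_of_nonneg_left ?_ (by positivity)
    simp only [hmis, hM]
    exact_mod_cast sum_card_level_filter_le (Mismatch evenWeight a) _
  have hinc2 : √m / 4 - 8 * √m / 2 ^ m * M ≤ A (p + 1 + q) - A (p - q) := by
    have e : 8 * √(m : ℝ) / 2 ^ m * M = 2 * (4 * √m / 2 ^ m * M) := by ring
    push_cast at hinc
    rw [e]
    linarith
  -- only the tails are kept
  obtain ⟨ht1, ht2⟩ := tails_ge hm hqp (by linarith)
  -- Subtracting `A p` is free because the signed binomial sum vanishes. Afterwards every term is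
  -- nonnegative, and the middle levels can be dropped.
  have hsum : ∑ z, (a z : ℝ) * halfSign p z = ∑ v ∈ Finset.range (m + 1),
      (if p + 1 ≤ v then (1 : ℝ) else -1) * (A v - A p) * m.choose v := by
    rw [sum_mul_halfSign]
    have h0 := sum_sign_choose hm
    have h1 : ∑ v ∈ Finset.range (m + 1),
        (if p + 1 ≤ v then (1 : ℝ) else -1) * (A v - A p) * m.choose v =
        ∑ v ∈ Finset.range (m + 1), (if p + 1 ≤ v then (1 : ℝ) else -1) * (m.choose v * A v) -
        (∑ v ∈ Finset.range (m + 1), (if p + 1 ≤ v then (1 : ℝ) else -1) * m.choose v) * A p := by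
      rw [Finset.sum_mul, ← Finset.sum_sub_distrib]
      exact Finset.sum_congr rfl fun v _ => by ring
    rw [h1, h0, zero_mul, sub_zero]
    refine Finset.sum_congr rfl fun v hv => ?_
    rw [hlevel v (by have := Finset.mem_range.1 hv; omega)]
  rw [hsum]
  have hlow : (A p - A (p - q)) * (2 ^ m / 4) ≤ ∑ v ∈ Finset.range (p + 1),
      (if p + 1 ≤ v then (1 : ℝ) else -1) * (A v - A p) * m.choose v := by
    have hterm : ∀ v ∈ Finset.range (p + 1),
        (if p + 1 ≤ v then (1 : ℝ) else -1) * (A v - A p) * m.choose v =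
        (A p - A v) * m.choose v := by
      intro v hv
      rw [if_neg (by have := Finset.mem_range.1 hv; omega)]
      ring
    rw [Finset.sum_congr rfl hterm]
    calc (A p - A (p - q)) * (2 ^ m / 4)
        ≤ (A p - A (p - q)) * ∑ v ∈ Finset.range (p - q + 1), (m.choose v : ℝ) :=
          mul_le_mul_of_nonneg_left ht1 (sub_nonneg.2 (hAmono (Nat.sub_le _ _)))
      _ ≤ ∑ v ∈ Finset.range (p - q + 1), (A p - A v) * m.choose v := by
          rw [Finset.mul_sum]
          refine Finset.sum_le_sum fun v hv => mul_le_mul_of_nonneg_right ?_ (by positivity)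
          have := hAmono (show v ≤ p - q by have := Finset.mem_range.1 hv; omega)
          linarith
      _ ≤ _ := Finset.sum_le_sum_of_subset_of_nonneg (Finset.range_mono (by omega))
          fun v hv _ => mul_nonneg (sub_nonneg.2 (hAmono (by
            have := Finset.mem_range.1 hv; omega))) (by positivity)
  have hhigh : (A (p + 1 + q) - A p) * (2 ^ m / 4) ≤ ∑ v ∈ Finset.Ico (p + 1) (m + 1),
      (if p + 1 ≤ v then (1 : ℝ) else -1) * (A v - A p) * m.choose v := by
    have hterm : ∀ v ∈ Finset.Ico (p + 1) (m + 1),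
        (if p + 1 ≤ v then (1 : ℝ) else -1) * (A v - A p) * m.choose v =
        (A v - A p) * m.choose v := by
      intro v hv
      rw [if_pos (Finset.mem_Ico.1 hv).1, one_mul]
    rw [Finset.sum_congr rfl hterm]
    calc (A (p + 1 + q) - A p) * (2 ^ m / 4)
        ≤ (A (p + 1 + q) - A p) * ∑ v ∈ Finset.Ico (p + 1 + q) (m + 1), (m.choose v : ℝ) :=
          mul_le_mul_of_nonneg_left ht2 (sub_nonneg.2 (hAmono (by omega)))
      _ ≤ ∑ v ∈ Finset.Ico (p + 1 + q) (m + 1), (A v - A p) * m.choose v := by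
          rw [Finset.mul_sum]
          refine Finset.sum_le_sum fun v hv => mul_le_mul_of_nonneg_right ?_ (by positivity)
          have := hAmono (Finset.mem_Ico.1 hv).1
          linarith
      _ ≤ _ := Finset.sum_le_sum_of_subset_of_nonneg (Finset.Ico_subset_Ico_left (by omega))
          fun v hv _ => mul_nonneg (sub_nonneg.2 (hAmono (by
            have := Finset.mem_Ico.1 hv; omega))) (by positivity)
  rw [← Finset.sum_range_add_sum_Ico _ (show p + 1 ≤ m + 1 by omega)]
  have hpow : (0 : ℝ) < 2 ^ m := by positivity
  have hfin : (√m / 4 - 8 * √m / 2 ^ m * M) * (2 ^ m / 4) =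
      2 ^ m * √m / 16 - 2 * √m * M := by
    field_simp
    ring
  have := mul_le_mul_of_nonneg_right hinc2 (show (0 : ℝ) ≤ 2 ^ m / 4 by positivity)
  rw [hfin] at this
  linarith
/-! ### The two-level function -/

/-- Between two consecutive points of an alternation the value changes, so some step there is
relevant. The `k` time intervals are disjoint. -/
theorem forcesSteps_of_update {κ : Type} [DecidableEq κ] {G : Cube κ → Bool}
    {rel : Cube κ → Finset κ}
    (hG : ∀ y c, c ∉ rel y → G (Function.update y c true) = G y) (k : ℕ) :
    ForcesSteps G rel k k := by
  intro Y S hY t ht halt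
  have hconst : ∀ s, s ∉ S → G (Y (s + 1)) = G (Y s) := by
    intro s hs
    rcases hY s with h | ⟨c, -, h, h2⟩
    · rw [h]
    · rw [h]
      exact hG _ _ fun hc => hs (h2 hc)
  have hexists : ∀ j < k, ∃ s ∈ S, t j ≤ s ∧ s < t (j + 1) := by
    intro j hj
    by_contra! hno
    have hc : ∀ d, t j + d ≤ t (j + 1) → G (Y (t j + d)) = G (Y (t j)) := by
      intro d hd
      induction d with
      | zero => rfl
      | succ d ih =>
        rw [← ih (by omega), ← add_assoc]
        refine hconst _ fun hs => ?_
        have := hno _ hs (by omega)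
        omega
    have h1 := hc (t (j + 1) - t j) (by have := ht j hj; omega)
    rw [Nat.add_sub_cancel' (ht j hj).le] at h1
    have h2 := halt j hj.le
    have h3 := halt (j + 1) hj
    rw [h1, h2, Nat.even_add_one] at h3
    tauto
  have hcount : ∀ j ≤ k, t 0 ≤ t j ∧ j ≤ ((Finset.Ico (t 0) (t j)).filter (· ∈ S)).card := by
    intro j hj
    induction j with
    | zero => simp
    | succ j ih =>
      obtain ⟨h0, h1⟩ := ih (by omega)
      obtain ⟨s, hs, hs1, hs2⟩ := hexists j hj
      refine ⟨by omega, ?_⟩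
      have hsub : insert s ((Finset.Ico (t 0) (t j)).filter (· ∈ S)) ⊆
          (Finset.Ico (t 0) (t (j + 1))).filter (· ∈ S) := by
        intro u hu
        simp only [Finset.mem_insert, Finset.mem_filter, Finset.mem_Ico] at hu ⊢
        rcases hu with rfl | ⟨hu, hu2⟩
        · exact ⟨⟨by omega, hs2⟩, hs⟩
        · exact ⟨⟨hu.1, by omega⟩, hu2⟩
      have := Finset.card_le_card hsub
      rw [Finset.card_insert_of_notMem (by simp; omega)] at this
      omega
  exact (hcount k le_rfl).2

section
variable {m : ℕ}

theorem sum_two_weight_sub (x : Cube (Fin m)) :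
    ∑ c, (if x c = true then (1 : ℝ) else -1) = 2 * weight x - m := by
  have h1 : ∀ c, (if x c = true then (1 : ℝ) else -1) = 2 * (if x c = true then 1 else 0) - 1 := by
    intro c; split_ifs <;> norm_num
  simp only [h1, Finset.sum_sub_distrib, ← Finset.mul_sum, Finset.sum_boole]
  simp [weight, weightOn]

theorem sum_abs_two_weight_sub_le :
    ∑ x : Cube (Fin m), |2 * (weight x : ℝ) - m| ≤ √m * 2 ^ m := by
  have h := sum_abs_sum_le (I := Fin m) (F := fun b : Bool => if b = true then (1 : ℝ) else -1)
    (by simp) (by intro b; cases b <;> simp) Finset.univ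
  simp only [sum_two_weight_sub] at h
  simpa using h

theorem sum_weight : ∑ x : Cube (Fin m), (weight x : ℝ) = m * 2 ^ m / 2 := by
  have h : ∀ x : Cube (Fin m), (weight x : ℝ) = (∑ c, (if x c = true then (1 : ℝ) else -1) + m) / 2 := by
    intro x; rw [sum_two_weight_sub]; ring
  have h0 : ∀ c : Fin m, ∑ x : Cube (Fin m), (if x c = true then (1 : ℝ) else -1) = 0 := by
    intro c
    rw [← Equiv.sum_comp (Equiv.funSplitAt c Bool).symm, Fintype.sum_prod_type, Finset.sum_comm]
    refine Finset.sum_eq_zero fun r _ => ?_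
    simp [Equiv.funSplitAt, Equiv.piSplitAt]
  simp only [h, ← Finset.sum_div, Finset.sum_add_distrib]
  rw [Finset.sum_comm]
  simp only [h0]
  simp
  ring

/-- The coordinates of the two-level function: an address, and the blocks. -/
abbrev TwoLevel (m : ℕ) : Type := Fin m ⊕ (Fin m × Fin m)

/-- A point of the two-level cube, from an address part and blocks. -/
def twoLevelMk (x : Cube (Fin m)) (y : Fin m → Cube (Fin m)) : Cube (TwoLevel m) :=
  Sum.elim x fun q => y q.1 q.2

theorem card_filter_twoLevel (P : Cube (TwoLevel m) → Prop) [DecidablePred P] :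
    (Finset.univ.filter P).card = ∑ x : Cube (Fin m),
      (Finset.univ.filter fun y : Fin m → Cube (Fin m) => P (twoLevelMk x y)).card := by
  rw [← Finset.card_sigma]
  symm
  refine Finset.card_bij (fun q _ => twoLevelMk q.1 q.2) ?_ ?_ ?_
  · intro q hq
    simpa using hq
  · rintro ⟨x, y⟩ - ⟨x', y'⟩ - h
    have h1 : x = x' := funext fun i => congrFun h (.inl i)
    have h2 : y = y' := funext fun j => funext fun i => congrFun h (.inr (j, i))
    rw [h1, h2]
  · intro z hz
    have e : twoLevelMk (fun i => z (.inl i)) (fun j i => z (.inr (j, i))) = z := by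
      funext s
      rcases s with s | ⟨j, i⟩ <;> rfl
    refine ⟨⟨fun i => z (.inl i), fun j i => z (.inr (j, i))⟩, ?_, e⟩
    simp only [Finset.mem_sigma, Finset.mem_univ, Finset.mem_filter, true_and, e] at hz ⊢
    exact hz

/-- Correlation of a monotone function with the half of the addressed block. -/
theorem le_sum_block {p : ℕ} (hm : m = 2 * p + 1) (hm25 : 25 ≤ m) (j : Fin m)
    {a : (Fin m → Cube (Fin m)) → ℕ} (ha : Monotone a) :
    (Fintype.card (Fin m → Cube (Fin m)) : ℝ) * √m / 16 - 2 * √m *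
      ((Finset.univ.filter fun y => ¬ (evenWeight (y j) = true ↔ Odd (a y))).card : ℝ) ≤
      ∑ y, (a y : ℝ) * halfSign p (y j) := by
  -- With all blocks other than `j` fixed, this is the statement for one block, summed over the
  -- slices.
  set e := (Equiv.funSplitAt j (Cube (Fin m))).symm with he
  have hej : ∀ z r, e (z, r) j = z := by
    intro z r; simp [he, Equiv.funSplitAt, Equiv.piSplitAt]
  have hemono : ∀ r, Monotone fun z => e (z, r) := by
    intro r z z' hz i
    by_cases h : i = j
    · subst h
      change e (z, r) i ≤ e (z', r) i
      rw [hej, hej]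
      exact hz
    · simp [he, Equiv.funSplitAt, Equiv.piSplitAt, h]
  have hcard : (Fintype.card (Fin m → Cube (Fin m)) : ℝ) =
      2 ^ m * (Fintype.card ({i // i ≠ j} → Cube (Fin m)) : ℝ) := by
    rw [← Fintype.card_congr e, Fintype.card_prod]
    simp
  have hmis : ((Finset.univ.filter fun y => ¬ (evenWeight (y j) = true ↔ Odd (a y))).card : ℝ) =
      ∑ r, ((Finset.univ.filter (Mismatch evenWeight fun z => a (e (z, r)))).card : ℝ) := by
    rw [Finset.card_filter, ← Equiv.sum_comp e, Fintype.sum_prod_type, Finset.sum_comm]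
    push_cast
    refine Finset.sum_congr rfl fun r _ => ?_
    rw [Finset.card_filter]
    push_cast
    refine Finset.sum_congr rfl fun z _ => ?_
    simp only [hej]
    exact if_congr Iff.rfl rfl rfl
  rw [← Equiv.sum_comp e, Fintype.sum_prod_type, Finset.sum_comm, hmis, hcard, Finset.mul_sum]
  have h := Finset.sum_le_sum fun (r : {i // i ≠ j} → Cube (Fin m)) (_ : r ∈ Finset.univ) =>
    le_sum_mul_halfSign hm hm25 (ha.comp (hemono r))
  rw [Finset.sum_sub_distrib, Finset.sum_const, Finset.card_univ, nsmul_eq_mul] at h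
  simp only [hej]
  refine le_trans (le_of_eq ?_) h
  congr 1
  ring

variable [NeZero m]

/-- The address of a block: the sum of the coordinates that are set, modulo `m`. -/
def addr (x : Cube (Fin m)) : Fin m := ∑ c, if x c = true then c else 0

/-- From a given address, different unset bits `c` thus lead to different blocks, as the
orthogonality argument requires. -/
theorem addr_update {x : Cube (Fin m)} {c : Fin m} (hc : x c = false) :
    addr (Function.update x c true) = addr x + c := by
  have : ∀ i, (if Function.update x c true i = true then i else 0) =
      (if x i = true then i else 0) + if i = c then c else 0 := by
    intro i
    rcases eq_or_ne i c with h | h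
    · subst h; simp [hc]
    · simp [h]
  simp only [addr, this, Finset.sum_add_distrib, Finset.sum_ite_eq', Finset.mem_univ, if_true]

/-- The parity of the weight of the block that is addressed. -/
def twoLevel (y : Cube (TwoLevel m)) : Bool :=
  evenWeight fun i => y (.inr (addr (fun c => y (.inl c)), i))

/-- The coordinates on which the two-level function depends locally. -/
def twoLevelRel (y : Cube (TwoLevel m)) : Finset (TwoLevel m) :=
  (Finset.univ.image Sum.inl) ∪
    Finset.univ.image fun i : Fin m => Sum.inr (addr (fun c => y (.inl c)), i)

theorem card_twoLevelRel_le (y : Cube (TwoLevel m)) : (twoLevelRel y).card ≤ 2 * m := by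
  refine (Finset.card_union_le _ _).trans ?_
  have h1 := Finset.card_image_le (s := (Finset.univ : Finset (Fin m)))
    (f := (Sum.inl : Fin m → TwoLevel m))
  have h2 := Finset.card_image_le (s := (Finset.univ : Finset (Fin m)))
    (f := fun i : Fin m => (Sum.inr (addr (fun c => y (.inl c)), i) : TwoLevel m))
  rw [Finset.card_univ, Fintype.card_fin] at h1 h2
  omega

theorem twoLevel_update {y : Cube (TwoLevel m)} {c : TwoLevel m} (hc : c ∉ twoLevelRel y) :
    twoLevel (Function.update y c true) = twoLevel y := by
  rcases c with c | ⟨j, i⟩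
  · exact absurd (by simp [twoLevelRel]) hc
  · have hj : j ≠ addr fun c => y (.inl c) := by
      rintro rfl
      exact hc (by simp [twoLevelRel])
    have h1 : (fun c => Function.update y (.inr (j, i)) true (.inl c)) = fun c => y (.inl c) := by
      funext c; simp
    unfold twoLevel
    rw [h1]
    congr 1
    funext i'
    rw [Function.update_of_ne]
    intro h
    simp only [Sum.inr.injEq, Prod.mk.injEq] at h
    exact hj h.1.symm

theorem forcesSteps_twoLevel (k : ℕ) :
    ForcesSteps (twoLevel (m := m)) twoLevelRel k k :=
  forcesSteps_of_update (fun _ _ hc => twoLevel_update hc) k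

/-- Compare the rank at both ends of an address edge `x → x + c`. At the upper end its correlation
with the new block `addr x + c` is about `√m / 16`. At the lower end its correlations with all the
blocks reachable from `x` sum to at most `g√m`. The difference bounds the mean rise of the rank from
below, while over all the edges at an average `x` the total rise is at most `g√m`. So `m/32 ≤ 2g` up
to mismatches, which `128 * g ≤ m` refutes. -/
theorem farFromRanks_twoLevel {p g : ℕ} (hm : m = 2 * p + 1) (hm25 : 25 ≤ m)
    (hg : 128 * g ≤ m) : FarFromRanks (1 / 128) g (twoLevel (m := m)) := by
  intro a ha hag
  set Ω := Fin m → Cube (Fin m)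
  set N : ℝ := (Fintype.card Ω : ℝ) with hN
  have hN0 : 0 ≤ N := Nat.cast_nonneg _
  set s := √(m : ℝ) with hs
  have hm0 : (0 : ℝ) < m := by exact_mod_cast (by omega : 0 < m)
  have hs0 : 0 < s := Real.sqrt_pos.2 hm0
  set A : Cube (Fin m) → Ω → ℝ := fun x y => a (twoLevelMk x y) with hA
  have hmk : ∀ {x x' : Cube (Fin m)} {y y' : Ω}, x ≤ x' → y ≤ y' →
      twoLevelMk x y ≤ twoLevelMk x' y' := by
    intro x x' y y' hx hy q
    rcases q with q | ⟨j, i⟩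
    · exact hx q
    · exact hy j i
  have hA0 : ∀ x y, 0 ≤ A x y := fun x y => Nat.cast_nonneg _
  have hAg : ∀ x y, A x y ≤ g := fun x y => by
    simp only [hA]; exact_mod_cast hag _
  set mis : Cube (Fin m) → ℝ := fun x =>
    ((Finset.univ.filter fun y : Ω => Mismatch twoLevel a (twoLevelMk x y)).card : ℝ) with hmis
  set S : Cube (Fin m) → ℝ := fun x => ∑ y, A x y * halfSign p (y (addr x)) with hS
  have hSge : ∀ x, N * s / 16 - 2 * s * mis x ≤ S x := fun x =>
    le_sum_block hm hm25 (addr x) (a := fun y => a (twoLevelMk x y)) fun y y' hy => ha (hmk le_rfl hy)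
  -- moving up in the direction `c`
  have hpair : ∀ x c, x c = false → S (Function.update x c true) -
      ∑ y, A x y * halfSign p (y (addr x + c)) ≤
      ∑ y, A (Function.update x c true) y - ∑ y, A x y := by
    intro x c hc
    simp only [hS, addr_update hc]
    rw [← Finset.sum_sub_distrib, ← Finset.sum_sub_distrib]
    refine Finset.sum_le_sum fun y _ => ?_
    rw [← sub_mul]
    have h1 : 0 ≤ A (Function.update x c true) y - A x y := by
      rw [sub_nonneg]
      simp only [hA]
      exact_mod_cast ha (hmk (le_update_true x c) le_rfl)
    exact mul_le_of_le_one_right h1 (halfSign_le_one p _)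
  set Z : Cube (Fin m) → Finset (Fin m) := fun x => Finset.univ.filter fun c => x c = false with hZ
  have hones : ∀ x : Cube (Fin m), (Finset.univ.filter fun c => x c = true).card = weight x :=
    fun x => rfl
  have hzeros : ∀ x : Cube (Fin m), ((Z x).card : ℝ) = m - weight x := by
    intro x
    have := Finset.card_filter_add_card_filter_not (s := Finset.univ) (fun c => x c = true)
    rw [hones, Finset.card_univ, Fintype.card_fin] at this
    simp only [Bool.not_eq_true] at this
    have h2 : (weight x : ℝ) + (Z x).card = m := by exact_mod_cast this
    linarith
  have hsum := Finset.sum_le_sum fun x (_ : x ∈ (Finset.univ : Finset (Cube (Fin m)))) =>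
    Finset.sum_le_sum fun c (hc : c ∈ Z x) => hpair x c (by simpa [hZ] using hc)
  simp only [Finset.sum_sub_distrib] at hsum
  -- Indexing edges by their upper endpoint gives each `x` the multiplicity `weight x`.
  have e1 := sum_filter_update (m := m) fun x _ => S x
  have e2 := sum_filter_update (m := m) fun x _ => ∑ y, A x y
  simp only [hZ] at hsum
  rw [e1, e2] at hsum
  simp only [Finset.sum_const, nsmul_eq_mul, hones] at hsum
  change _ ≤ _ - ∑ x, ((Z x).card : ℝ) * ∑ y, A x y at hsum
  -- the level inequality for the address
  have hright : ∑ x : Cube (Fin m), (weight x : ℝ) * ∑ y, A x y -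
      ∑ x, ((Z x).card : ℝ) * ∑ y, A x y ≤ g * N * (s * 2 ^ m) := by
    rw [← Finset.sum_sub_distrib]
    calc _ ≤ ∑ x : Cube (Fin m), g * N * |2 * (weight x : ℝ) - m| := by
          refine Finset.sum_le_sum fun x _ => ?_
          rw [← sub_mul, hzeros]
          have h1 : ∑ y, A x y ≤ g * N := by
            calc ∑ y, A x y ≤ ∑ y : Ω, (g : ℝ) := Finset.sum_le_sum fun y _ => hAg x y
              _ = g * N := by rw [Finset.sum_const, Finset.card_univ, nsmul_eq_mul, mul_comm]
          have h2 : 0 ≤ ∑ y, A x y := Finset.sum_nonneg fun y _ => hA0 x y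
          calc ((weight x : ℝ) - (m - weight x)) * ∑ y, A x y
              ≤ |2 * (weight x : ℝ) - m| * ∑ y, A x y := by
                refine mul_le_mul_of_nonneg_right ?_ h2
                refine le_trans (le_of_eq ?_) (le_abs_self _)
                ring
            _ ≤ |2 * (weight x : ℝ) - m| * (g * N) := by gcongr
            _ = _ := by ring
      _ = g * N * ∑ x : Cube (Fin m), |2 * (weight x : ℝ) - m| := by rw [Finset.mul_sum]
      _ ≤ _ := by
          refine mul_le_mul_of_nonneg_left ?_ (by positivity)
          exact sum_abs_two_weight_sub_le
  -- the average over the neighbouring blocks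
  have hcross : ∑ x : Cube (Fin m), ∑ c ∈ Finset.univ.filter (fun c => x c = false),
      ∑ y, A x y * halfSign p (y (addr x + c)) ≤ 2 ^ m * (g * (s * N)) := by
    calc _ ≤ ∑ x : Cube (Fin m), (g : ℝ) * (s * N) := by
          refine Finset.sum_le_sum fun x _ => ?_
          rw [Finset.sum_comm]
          have horth := sum_abs_sum_le (I := Fin m) (sum_halfSign hm) (halfSign_sq p)
            ((Z x).map (addLeftEmbedding (addr x)))
          simp only [Finset.sum_map, addLeftEmbedding_apply, Fintype.card_fin] at horth
          refine le_trans ?_ (mul_le_mul_of_nonneg_left horth (Nat.cast_nonneg g))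
          rw [Finset.mul_sum]
          refine Finset.sum_le_sum fun y _ => ?_
          rw [← Finset.mul_sum]
          calc A x y * ∑ c ∈ Z x, halfSign p (y (addr x + c))
              ≤ A x y * |∑ c ∈ Z x, halfSign p (y (addr x + c))| :=
                mul_le_mul_of_nonneg_left (le_abs_self _) (hA0 x y)
            _ ≤ _ := mul_le_mul_of_nonneg_right (hAg x y) (abs_nonneg _)
      _ = _ := by simp
  have hleft : m * 2 ^ m / 2 * (N * s / 16) - 2 * s * m * ∑ x, mis x ≤
      ∑ x : Cube (Fin m), (weight x : ℝ) * S x := by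
    rw [← sum_weight, Finset.sum_mul, Finset.mul_sum, ← Finset.sum_sub_distrib]
    refine Finset.sum_le_sum fun x _ => ?_
    have hw : (weight x : ℝ) ≤ m := by exact_mod_cast weight_le x
    have hm0' : 0 ≤ mis x := Nat.cast_nonneg _
    calc (weight x : ℝ) * (N * s / 16) - 2 * s * m * mis x
        ≤ (weight x : ℝ) * (N * s / 16) - 2 * s * weight x * mis x := by gcongr
      _ = weight x * (N * s / 16 - 2 * s * mis x) := by ring
      _ ≤ _ := mul_le_mul_of_nonneg_left (hSge x) (Nat.cast_nonneg _)
  have hMIS : ((Finset.univ.filter (Mismatch twoLevel a)).card : ℝ) = ∑ x, mis x := by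
    rw [card_filter_twoLevel]
    push_cast
    rfl
  have hcardκ : (2 : ℝ) ^ Fintype.card (TwoLevel m) = 2 ^ m * N := by
    rw [hN]
    simp only [Fintype.card_sum, Fintype.card_prod, Fintype.card_fin, Fintype.card_fun, Ω,
      Fintype.card_bool, pow_add]
    push_cast
    rw [pow_mul]
  rw [hMIS, hcardκ]
  have hgm : 128 * (g : ℝ) ≤ m := by exact_mod_cast hg
  set M := ∑ x, mis x
  have hP : 0 ≤ 2 ^ m * N := by positivity
  have h1 : m * 2 ^ m / 2 * (N * s / 16) - 2 * s * m * M ≤ 2 * (g * N * (s * 2 ^ m)) := by linarith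
  have h2 : s * ((2 ^ m * N) * (m / 32 - 2 * g)) ≤ s * (2 * m * M) := by linarith
  have h3 := le_of_mul_le_mul_left h2 hs0
  -- Half of the main term `m / 32` absorbs `2 * g`; the other half is paid for by mismatches.
  have h4 : (2 ^ m * N) * ((m : ℝ) / 64) ≤ (2 ^ m * N) * (m / 32 - 2 * g) := by
    gcongr
    linarith
  have h5 : (m : ℝ) * (1 / 128 * (2 ^ m * N)) ≤ m * M := by linarith
  exact le_of_mul_le_mul_left h5 hm0

end
/-! ### The hidden balanced blocks function -/

/-- A blocks function depends only on the weight, so it can be moved from `Fin r` to the subtype of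
`R`. -/
theorem hidesBalancedBlocks_hide {n k g l r : ℕ} (hg : 1 ≤ g) (hrdef : r = numHidden n k g)
    (hr : 1 ≤ r) (e : Fin r ⊕ Fin l ≃ Fin n) :
    HidesBalancedBlocks k g (hide e k (winLo l) (winHi l) (blockFn (Fin r) (3 * g))) := by
  classical
  set inl : Fin r ↪ Fin n := ⟨fun i => e (.inl i), fun i j h => by simpa using h⟩ with hinl
  set inr : Fin l ↪ Fin n := ⟨fun i => e (.inr i), fun i j h => by simpa using h⟩ with hinr
  set R : Finset (Fin n) := Finset.univ.map inl with hR
  have hRc : Rᶜ = Finset.univ.map inr := by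
    ext i
    obtain ⟨j, rfl⟩ := e.surjective i
    simp only [hR, Finset.mem_compl, Finset.mem_map, Finset.mem_univ, true_and]
    rcases j with j | j
    · refine ⟨fun h => absurd ⟨j, rfl⟩ h, ?_⟩
      rintro ⟨a, ha⟩
      exact absurd (e.injective (show e (.inr a) = e (.inl j) from ha)) (by simp)
    · refine ⟨fun _ => ⟨j, rfl⟩, ?_⟩
      rintro - ⟨a, ha⟩
      exact absurd (e.injective (show e (.inl a) = e (.inr j) from ha)) (by simp)
  have hRcard : R.card = r := by simp [hR]
  have hRccard : Rᶜ.card = l := by simp [hRc]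
  have hwL : ∀ z : Cube (Fin n), weightOn Rᶜ z = weight fun i => z (e (.inr i)) := by
    intro z
    rw [hRc, weight, weightOn, weightOn, Finset.filter_map, Finset.card_map]
    rfl
  have hι : Fintype.card {i // i ∈ R} = r := by rw [Fintype.card_coe, hRcard]
  have hmem : ∀ i, inl i ∈ R := fun i => Finset.mem_map_of_mem _ (Finset.mem_univ i)
  have hbij : Function.Bijective fun i : Fin r => (⟨inl i, hmem i⟩ : {i // i ∈ R}) := by
    rw [Fintype.bijective_iff_injective_and_card]
    refine ⟨fun i j h => inl.injective (congrArg Subtype.val h), ?_⟩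
    rw [hι, Fintype.card_fin]
  have hwR : ∀ z : Cube (Fin n), weight (fun i : {i // i ∈ R} => z i) =
      weight fun i : Fin r => z (e (.inl i)) := by
    intro z
    exact (weight_comp_equiv (Equiv.ofBijective _ hbij) fun i : {i // i ∈ R} => z i).symm
  refine ⟨R, hRcard.trans hrdef, blockFn {i // i ∈ R} (3 * g),
    isBalancedBlocks_blockFn (by omega) (by rw [hι]; exact hr), fun z => ?_⟩
  rw [hRccard]
  have hz : hide e k (winLo l) (winHi l) (blockFn (Fin r) (3 * g)) z =
      if weightOn Rᶜ z < winLo l then false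
      else if weightOn Rᶜ z ≤ winHi l then blockFn {i // i ∈ R} (3 * g) (fun i => z i)
      else decide (Odd k) := by
    rw [hwL, hide]
    simp only [blockFn, hι, hwR, Fintype.card_fin]
  rw [hz]
  refine ⟨fun h => ?_, fun h => ?_, fun h => ?_⟩
  · rw [abs_le] at h
    rw [if_neg, if_pos]
    · rw [le_winHi_iff]; linarith [h.2]
    · rw [not_lt, winLo_le_iff]; linarith [h.1]
  · rw [if_pos]
    rw [← not_le, winLo_le_iff]
    linarith
  · have h1 : ¬ weightOn Rᶜ z ≤ winHi l := by rw [le_winHi_iff]; linarith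
    have h2 : ¬ weightOn Rᶜ z < winLo l := by
      have := Real.sqrt_nonneg (l : ℝ)
      rw [not_lt, winLo_le_iff]
      linarith
    rw [if_neg h2, if_neg h1, decide_eq_true_iff]

/-! ### The two regimes and the main theorem -/

/-- The exponent of the detection bound. -/
noncomputable def detExponent (n k g : ℕ) : ℝ := √(n : ℝ) / ((g : ℝ) / (k : ℝ)) ^ 2

theorem detExponent_nonneg (n k g : ℕ) : 0 ≤ detExponent n k g := by
  unfold detExponent; positivity

theorem numHidden_le {n k g : ℕ} (hkg : k ≤ g) (hg : 1 ≤ g) :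
    (numHidden n k g : ℝ) ≤ n * k ^ 2 / (625 * g ^ 2) ∧
    n * (k : ℝ) ^ 2 / (625 * g ^ 2) < numHidden n k g + 1 ∧ 625 * numHidden n k g ≤ n := by
  refine ⟨?_, ?_, ?_⟩
  · have := Nat.cast_div_le (α := ℝ) (m := n * k ^ 2) (n := 625 * g ^ 2)
    push_cast at this
    exact this
  · have : n * k ^ 2 < 625 * g ^ 2 * (numHidden n k g + 1) :=
      Nat.lt_mul_div_succ _ (by positivity)
    rw [div_lt_iff₀ (by positivity), mul_comm (_ + 1)]
    exact_mod_cast this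
  · have h1 : numHidden n k g * (625 * g ^ 2) ≤ n * k ^ 2 := Nat.div_mul_le_self _ _
    have h2 : n * k ^ 2 ≤ n * g ^ 2 := by gcongr
    have h3 : g ^ 2 * (625 * numHidden n k g) ≤ g ^ 2 * n := by linarith
    exact Nat.le_of_mul_le_mul_left h3 (by positivity)

/-- The properties of a hard function, for one value of `n`. -/
def IsHard {n : ℕ} (k g : ℕ) (f : BoolFn n) : Prop :=
  ∀ h ∈ coordOrbit f, IsFar (1 / 51200) h (kMonotone n g) ∧
    detectionProb k h ≤ Real.exp (-(detExponent n k g / 1000))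

theorem isFar_mono {n : ℕ} {ε ε' : ℝ} (h : ε ≤ ε') {f : BoolFn n} {P : Set (BoolFn n)}
    (hf : IsFar ε' f P) : IsFar ε f P := fun x hx => h.trans (hf x hx)

/-- The forced steps contribute more than `0.0022 * E` to the exponent and the expected number costs
at most `E / 4000`, leaving at least `E / 1000`. -/
theorem exists_hard_of_blocks {n k g : ℕ} (hk : 2 ≤ k) (hkg : k ≤ g) (hn : 1000000 ≤ n)
    (hr : 6 * (g : ℝ) ≤ √(numHidden n k g)) :
    ∃ f : BoolFn n, IsHard k g f ∧ HidesBalancedBlocks k g f := by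
  obtain ⟨hr1, hr2, hr3⟩ := numHidden_le (n := n) hkg (by omega)
  have hg2 : (2 : ℝ) ≤ g := by exact_mod_cast hk.trans hkg
  have hk2 : (2 : ℝ) ≤ k := by exact_mod_cast hk
  have hrpos : 1 ≤ numHidden n k g := by
    by_contra! h
    have : numHidden n k g = 0 := by omega
    rw [this] at hr
    simp at hr
    linarith
  set r := numHidden n k g with hrdef
  set l := n - r with hl
  have hln : r + l = n := by omega
  have hl1 : 40000 ≤ l := by omega
  obtain ⟨e₀⟩ : Nonempty (Fin r ⊕ Fin l ≃ Fin n) :=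
    ⟨Fintype.equivFinOfCardEq (by simpa using hln)⟩
  refine ⟨hide e₀ k (winLo l) (winHi l) (blockFn (Fin r) (3 * g)), fun h hh => ?_,
    hidesBalancedBlocks_hide (by omega) hrdef hrpos e₀⟩
  obtain ⟨e, rfl⟩ := mem_coordOrbit_hide hh
  have hn0 : (0 : ℝ) < n := by exact_mod_cast (by omega : 0 < n)
  have hsr : 0 < √(r : ℝ) := by linarith
  have hsn : 0 < √(n : ℝ) := Real.sqrt_pos.2 hn0
  have hsn2 : √(n : ℝ) ^ 2 = n := Real.sq_sqrt hn0.le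
  constructor
  · exact isFar_mono (by norm_num)
      (isFar_hide e (by norm_num) (farFromRanks_blockFn (by omega) hr) (card_window_ge hl1))
  set W : ℝ := √r / (6 * g) with hW
  have hW0 : 0 ≤ W := by positivity
  have hforce : ForcesSteps (blockFn (Fin r) (3 * g)) (fun _ => Finset.univ) k ⌈((k : ℝ) - 1) * W⌉₊ := by
    refine forcesSteps_blockFn hrpos (by omega) (W := W) ?_ (by omega)
      (Nat.ceil_lt_add_one (mul_nonneg (by linarith) hW0))
    have h1 : (2 : ℝ) ^ r / √r ≤ 2 ^ r / (6 * g) := by gcongr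
    have h2 : (2 : ℝ) ^ r * W / √r = 2 ^ r / (6 * g) := by rw [hW]; field_simp
    have h3 : (2 : ℝ) ^ r / (3 * g : ℕ) = 2 * (2 ^ r / (6 * g)) := by
      push_cast; field_simp; norm_num
    rw [h2, h3]
    linarith
  refine (detectionProb_hide_window_le hl1 e (fun _ => Finset.univ) (M := r) (fun _ => by simp)
    (by omega) hforce).trans (Real.exp_le_exp.2 ?_)
  have hD : ((k : ℝ) - 1) * W ≤ (⌈((k : ℝ) - 1) * W⌉₊ : ℝ) := Nat.le_ceil _
  set D : ℝ := (⌈((k : ℝ) - 1) * W⌉₊ : ℝ)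
  set E := detExponent n k g with hE
  have hE' : E = √n * k ^ 2 / g ^ 2 := by
    rw [hE, detExponent]; field_simp
  have hE0 : 0 ≤ E := detExponent_nonneg _ _ _
  set x : ℝ := √n * k / (25 * g) with hx
  have hx2 : x ^ 2 = n * k ^ 2 / (625 * g ^ 2) := by
    rw [hx, div_pow, mul_pow, hsn2]; ring
  have hx0 : 0 < x := by positivity
  have hsr2 : √(r : ℝ) ^ 2 = r := Real.sq_sqrt (Nat.cast_nonneg _)
  -- Rounding down in `numHidden` costs at most one, and `r ≥ 36 * g ^ 2` is large enough for a loss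
  -- of one percent.
  have hxr : 99 / 100 * x ≤ √r := by
    apply (pow_le_pow_iff_left₀ (by positivity) (by positivity) two_ne_zero).1
    rw [mul_pow, hsr2, hx2]
    nlinarith
  have hDE : 33 / 10000 * E ≤ D := by
    refine le_trans ?_ hD
    have h1 : (k : ℝ) / 2 * (99 / 100 * x / (6 * g)) ≤ (k - 1) * W := by
      rw [hW]
      gcongr <;> linarith
    refine le_trans (le_of_eq ?_) h1
    rw [hE', hx]
    field_simp
    norm_num
  have hrE : (r : ℝ) ≤ √n * E / 625 := by
    refine hr1.trans (le_of_eq ?_)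
    rw [hE']
    nth_rewrite 1 [← hsn2]
    field_simp
  have hls : 99 / 100 * √(n : ℝ) ≤ √l := by
    apply (pow_le_pow_iff_left₀ (by positivity) (by positivity) two_ne_zero).1
    rw [mul_pow, hsn2, Real.sq_sqrt (Nat.cast_nonneg _)]
    have h1 : 625 * (r : ℝ) ≤ n := by exact_mod_cast hr3
    have h2 : (r : ℝ) + l = n := by exact_mod_cast hln
    nlinarith
  have hfirst : 3 * (r : ℝ) / (20 * √l) ≤ E / 4000 := by
    have hl0 : 0 < √(l : ℝ) := by nlinarith
    rw [div_le_iff₀ (by positivity)]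
    have : E * (99 / 100 * √n) ≤ E * √l := by gcongr
    nlinarith
  have hlog : 69 / 100 ≤ Real.log 2 := by linarith [Real.log_two_gt_d9]
  have hDlog : 33 / 10000 * E * (69 / 100) ≤ D * Real.log 2 := by gcongr
  linarith

/-- Here `√r < 6g` gives `√n * k ≤ 175 * g ^ 2`, hence `E ≤ 175 * k`, so `k` forced relevant steps
suffice. -/
theorem exists_hard_of_large {n k g : ℕ} (hk : 2 ≤ k) (hkg : k ≤ g) (hn : 1000000 ≤ n)
    (hgn : 1000 * (g : ℝ) ≤ √n) (hr : √(numHidden n k g : ℝ) < 6 * g) :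
    ∃ f : BoolFn n, IsHard k g f := by
  obtain ⟨-, hr2, -⟩ := numHidden_le (n := n) hkg (by omega)
  have hg2 : (2 : ℝ) ≤ g := by exact_mod_cast hk.trans hkg
  have hk2 : (2 : ℝ) ≤ k := by exact_mod_cast hk
  have hn0 : (0 : ℝ) < n := by exact_mod_cast (by omega : 0 < n)
  have hnR : (1000000 : ℝ) ≤ n := by exact_mod_cast hn
  have hsn : 1000 ≤ √(n : ℝ) := by
    rw [Real.le_sqrt (by norm_num) hn0.le]
    norm_num
    exact hn
  have hsn2 : √(n : ℝ) ^ 2 = n := Real.sq_sqrt hn0.le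
  -- Odd, so that the two halves of a block balance, and at least `128 * g` for farness; `hgn` keeps
  -- `m + m * m` below `n / 4`.
  set m := 2 * (64 * g) + 1 with hm
  have hmR : (m : ℝ) ≤ 129 / 1000 * √n := by
    rw [hm]; push_cast; linarith
  have hm2 : (m : ℝ) + m * m ≤ n / 4 := by
    have : (m : ℝ) * m ≤ (129 / 1000 * √n) * (129 / 1000 * √n) := by gcongr
    nlinarith
  have hmn : 4 * (m + m * m) ≤ n := by
    have : 4 * ((m : ℝ) + m * m) ≤ n := by linarith
    exact_mod_cast this
  set l := n - (m + m * m) with hl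
  have hln : m + m * m + l = n := by omega
  have hl1 : 40000 ≤ l := by omega
  have hlR : (n : ℝ) * (3 / 4) ≤ l := by
    have : (m : ℝ) + m * m + l = n := by exact_mod_cast hln
    linarith
  obtain ⟨e₀⟩ : Nonempty (TwoLevel m ⊕ Fin l ≃ Fin n) :=
    ⟨Fintype.equivFinOfCardEq (by simpa using hln)⟩
  refine ⟨hide e₀ k (winLo l) (winHi l) twoLevel, fun h hh => ?_⟩
  obtain ⟨e, rfl⟩ := mem_coordOrbit_hide hh
  constructor
  -- The constant is `1/51200 = 1/400 * 1/128`.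
  · exact isFar_mono (by norm_num)
      (isFar_hide e (by norm_num) (farFromRanks_twoLevel hm (by omega) (by omega))
        (card_window_ge hl1))
  refine (detectionProb_hide_window_le hl1 e twoLevelRel card_twoLevelRel_le (by nlinarith)
    (forcesSteps_twoLevel k)).trans (Real.exp_le_exp.2 ?_)
  set E := detExponent n k g with hE
  have hE' : E = √n * k ^ 2 / g ^ 2 := by
    rw [hE, detExponent]; field_simp
  have hEk : E ≤ 175 * k := by
    have h1 : √(n : ℝ) * k / (25 * g) ≤ 7 * g := by
      apply (pow_le_pow_iff_left₀ (by positivity) (by positivity) two_ne_zero).1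
      have h2 : (√(n : ℝ) * k / (25 * g)) ^ 2 = n * k ^ 2 / (625 * g ^ 2) := by
        rw [div_pow, mul_pow, hsn2]; ring
      have h3 : (numHidden n k g : ℝ) ≤ (6 * g) ^ 2 := by
        rw [← Real.sq_sqrt (Nat.cast_nonneg (numHidden n k g))]
        gcongr
      rw [h2]
      nlinarith
    rw [div_le_iff₀ (by positivity)] at h1
    rw [hE', div_le_iff₀ (by positivity)]
    nlinarith
  have hls : 1 / 2 * √(n : ℝ) ≤ √l := by
    apply (pow_le_pow_iff_left₀ (by positivity) (by positivity) two_ne_zero).1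
    rw [mul_pow, hsn2, Real.sq_sqrt (Nat.cast_nonneg _)]
    linarith
  have hfirst : 3 * ((2 * m : ℕ) : ℝ) / (20 * √l) ≤ 1 / 10 := by
    have hl0 : 0 < √(l : ℝ) := by linarith
    rw [div_le_iff₀ (by positivity)]
    push_cast
    linarith
  have hlog : 69 / 100 ≤ Real.log 2 := by linarith [Real.log_two_gt_d9]
  have hklog : (k : ℝ) * (69 / 100) ≤ k * Real.log 2 := by gcongr
  linarith

theorem exists_hard {n k g : ℕ} (hk : 2 ≤ k) (hkg : k ≤ g) (hn : 1000000 ≤ n)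
    (hgn : 1000 * (g : ℝ) ≤ √n) :
    ∃ f : BoolFn n, IsHard k g f ∧
      (6 * (g : ℝ) ≤ √(numHidden n k g) → HidesBalancedBlocks k g f) := by
  rcases le_or_gt (6 * (g : ℝ)) √(numHidden n k g) with h | h
  · obtain ⟨f, h1, h2⟩ := exists_hard_of_blocks hk hkg hn h
    exact ⟨f, h1, fun _ => h2⟩
  · obtain ⟨f, h1⟩ := exists_hard_of_large hk hkg hn hgn h
    exact ⟨f, h1, fun h2 => absurd h2 (not_le.2 h)⟩

theorem mainTheorem4 :
    ∃ C : ℝ, 0 < C ∧ ∃ ε : ℝ, 0 < ε ∧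
      ∀ (k : ℕ → ℕ) (g : ℕ → ℕ → ℕ),
        (∀ᶠ n : ℕ in atTop, 2 ≤ k n ∧ k n ≤ g (k n) n) →
        (fun n : ℕ => (g (k n) n : ℝ)) =o[atTop] (fun n : ℕ => √(n : ℝ)) →
        ∃ f : (n : ℕ) → BoolFn n,
          -- every member of the family is far, and hard for a random chain
          (∀ᶠ n : ℕ in atTop, ∀ h ∈ coordOrbit (f n),
            IsFar ε h (kMonotone n (g (k n) n)) ∧
            detectionProb (k n) h ≤
              Real.exp (-C * (√(n : ℝ) / ((g (k n) n : ℝ) / (k n : ℝ)) ^ 2))) ∧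
          -- little-o form of the bound when its exponent is unbounded
          (Tendsto (fun n : ℕ => √(n : ℝ) / ((g (k n) n : ℝ) / (k n : ℝ)) ^ 2) atTop atTop →
            ∀ δ : ℝ, 0 < δ → ∀ᶠ n : ℕ in atTop, ∀ h ∈ coordOrbit (f n),
              detectionProb (k n) h ≤
                δ * Real.exp (-C * (√(n : ℝ) / ((g (k n) n : ℝ) / (k n : ℝ)) ^ 2))) ∧
          -- the family consists of hidden balanced blocks functions, whenever these make sense
          ((fun n : ℕ => 3 * (g (k n) n : ℝ)) =o[atTop]
              (fun n : ℕ => √(numHidden n (k n) (g (k n) n) : ℝ)) →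
            ∀ᶠ n : ℕ in atTop, HidesBalancedBlocks (k n) (g (k n) n) (f n)) := by
  classical
  -- Half of the constant `1 / 1000` of `IsHard`: the spare factor `exp (-E / 2000)` falls below any
  -- `δ` when the exponent tends to infinity.
  refine ⟨1 / 2000, by norm_num, 1 / 51200, by norm_num, fun k g hkg hg => ?_⟩
  set Good : ℕ → Prop := fun n => (2 ≤ k n ∧ k n ≤ g (k n) n) ∧ 1000000 ≤ n ∧
    1000 * (g (k n) n : ℝ) ≤ √n
  have hgood : ∀ᶠ n in atTop, Good n := by
    filter_upwards [hkg, eventually_ge_atTop 1000000,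
      hg.bound (show (0 : ℝ) < 1 / 1000 by norm_num)] with n h1 h2 h3
    refine ⟨h1, h2, ?_⟩
    rw [Real.norm_of_nonneg (Nat.cast_nonneg _), Real.norm_of_nonneg (Real.sqrt_nonneg _)] at h3
    linarith
  have hex : ∀ n, ∃ f : BoolFn n, Good n → IsHard (k n) (g (k n) n) f ∧
      (6 * (g (k n) n : ℝ) ≤ √(numHidden n (k n) (g (k n) n)) →
        HidesBalancedBlocks (k n) (g (k n) n) f) := by
    intro n
    by_cases h : Good n
    · obtain ⟨f, hf⟩ := exists_hard h.1.1 h.1.2 h.2.1 h.2.2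
      exact ⟨f, fun _ => hf⟩
    · exact ⟨fun _ => false, fun h' => absurd h' h⟩
  choose f hf using hex
  refine ⟨f, ?_, ?_, ?_⟩
  · filter_upwards [hgood] with n hn h hh
    obtain ⟨h1, h2⟩ := (hf n hn).1 h hh
    refine ⟨h1, h2.trans (Real.exp_le_exp.2 ?_)⟩
    have := detExponent_nonneg n (k n) (g (k n) n)
    change _ ≤ -(1 / 2000) * detExponent n (k n) (g (k n) n)
    linarith
  · intro htend δ hδ
    filter_upwards [hgood, htend.eventually_ge_atTop (-2000 * Real.log δ)] with n hn hE h hh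
    refine ((hf n hn).1 h hh).2.trans ?_
    rw [← Real.exp_log hδ, ← Real.exp_add, Real.exp_le_exp]
    change _ ≤ detExponent n (k n) (g (k n) n) at hE
    change _ ≤ Real.log δ + -(1 / 2000) * detExponent n (k n) (g (k n) n)
    linarith
  · intro ho
    -- The ratio `1 / 2` turns `3g = o(√r)` into `6g ≤ √r`, the condition of the blocks regime.
    filter_upwards [hgood, ho.bound (show (0 : ℝ) < 1 / 2 by norm_num)] with n hn h3
    refine (hf n hn).2 ?_
    rw [Real.norm_of_nonneg (by positivity), Real.norm_of_nonneg (Real.sqrt_nonneg _)] at h3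
    linarith
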